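/- An \emph{ai-semiring} is an algebra $(S,+,\cdot)$ on a nonempty set such that $(S,+)$ is a semilattice (a commutative idempotent semigroup), $(S,\cdot)$ is a semigroup, and both distributive laws hold. It is \emph{flat} if it has a multiplicative zero $0$ and $a+b=0$ for all $a\neq b$. A \emph{variety} of ai-semirings is a class closed under homomorphic images, subalgebras and direct products; it is \emph{finitely based} if it can be defined by finitely many identities, and \emph{limit} if it is not finitely based but each of its proper subvarieties is. Let $S_c(abc)$ be the set of the seven nonempty subwords $a,b,c,ab,ac,bc,abc$ of the word $abc$ in the free commutative semigroup over three distinct letters $a,b,c$, together with a new symbol $0$, where $u\cdot v$ is the product $uv$ in the free commutative semigroup if this is again a nonempty subword of $abc$, and $u\cdot v=0$ otherwise, and where $u+u=u$ and $u+v=0$ for $u\neq v$. For a group $G$, the \emph{flat extension} $\flat(G)$ is $G\cup\{0\}$ with $0$ a new multiplicative zero, with $x+x=x$, and with $x+y=0$ for $x\neq y$. \textbf{Theorem.} $S_c(abc)$ is a flat semiring, and the ai-semiring variety $\mathsf{V}(S_c(abc))$ that it generates is a limit variety: it is nonfinitely based, while all its proper subvarieties are finitely based. Moreover, $\mathsf{V}(S_c(abc))$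 is combinatorial, that is, it is generated by a finite algebra and every subgroup of the multiplicative reduct of each of its members is trivial; and it contains no flat extension $\flat(G)$ of a group $G$. -/

import Mathlib

/-- An additively idempotent semiring: `(S, +)` is a semilattice, `(S, *)` is a semigroup, and both
distributive laws hold.  The signature is `{+, *}` (no constants are required to exist), and algebras
are nonempty, as usual in universal algebra. -/
class AiSemiring (S : Type*) extends AddCommSemigroup S, Semigroup S, Distrib S where
  /-- Addition is idempotent. -/
  add_idem : ∀ a : S, a + a = a
  /-- The universe of an algebra is nonempty. -/
  nonempty : Nonempty S

namespace AiSemiring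

/-! ### Terms, identities, varieties -/

/-- Terms of the signature `{+, *}` over a set of variables. -/
inductive Term (X : Type*) where
  | var : X → Term X
  | add : Term X → Term X → Term X
  | mul : Term X → Term X → Term X

/-- The value of a term under an assignment of the variables. -/
def Term.eval {X : Type*} {A : Type*} [AiSemiring A] (v : X → A) : Term X → A
  | .var x => v x
  | .add s t => s.eval v + t.eval v
  | .mul s t => s.eval v * t.eval v

/-- An identity `s ≈ t`, in countably many variables. -/
abbrev Identity : Type := Term ℕ × Term ℕ

/-- `A` satisfies the identity `s ≈ t`. -/
def Satisfies (A : Type) [AiSemiring A] (e : Identity) : Prop :=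
  ∀ v : ℕ → A, e.1.eval v = e.2.eval v

/-- Homomorphisms of ai-semirings. -/
def IsHom {A B : Type*} [AiSemiring A] [AiSemiring B] (f : A → B) : Prop :=
  (∀ x y, f (x + y) = f x + f y) ∧ (∀ x y, f (x * y) = f x * f y)

/-- Direct products, with coordinatewise operations. -/
instance instPi {I : Type*} (A : I → Type*) [∀ i, AiSemiring (A i)] : AiSemiring (∀ i, A i) where
  add f g := fun i => f i + g i
  mul f g := fun i => f i * g i
  add_assoc f g h := funext fun i => add_assoc (f i) (g i) (h i)
  add_comm f g := funext fun i => add_comm (f i) (g i)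
  mul_assoc f g h := funext fun i => mul_assoc (f i) (g i) (h i)
  left_distrib f g h := funext fun i => left_distrib (f i) (g i) (h i)
  right_distrib f g h := funext fun i => right_distrib (f i) (g i) (h i)
  add_idem f := funext fun i => add_idem (f i)
  nonempty := ⟨fun i => Classical.choice (nonempty (S := A i))⟩

/-- A class of ai-semirings. -/
abbrev AlgClass : Type 1 := ∀ (A : Type) [AiSemiring A], Prop

/-- A variety: a class closed under homomorphic images, (isomorphic copies of) subalgebras and
direct products.  It contains the one-element algebra, as the product of the empty family. -/
structure IsVariety (V : AlgClass) : Prop where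
  image : ∀ (A B : Type) [AiSemiring A] [AiSemiring B] (f : A → B),
    IsHom f → Function.Surjective f → V A → V B
  sub : ∀ (A B : Type) [AiSemiring A] [AiSemiring B] (f : A → B),
    IsHom f → Function.Injective f → V B → V A
  prod : ∀ (I : Type) (A : I → Type) [∀ i, AiSemiring (A i)],
    (∀ i, V (A i)) → V (∀ i, A i)

/-- The variety generated by `S`: the intersection of all varieties containing `S`. -/
def generatedVariety (S : Type) [AiSemiring S] : AlgClass :=
  fun A _ => ∀ V : AlgClass, IsVariety V → V S → V A

/-- `V` is finitely based: within ai-semirings (themselves given by finitely many identities) it is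
defined by finitely many identities. -/
def IsFinitelyBased (V : AlgClass) : Prop :=
  ∃ E : Finset Identity, ∀ (A : Type) [AiSemiring A], V A ↔ ∀ e ∈ E, Satisfies A e

/-- `W` is a proper subvariety of `V`. -/
def IsProperSubvariety (W V : AlgClass) : Prop :=
  IsVariety W ∧ (∀ (A : Type) [AiSemiring A], W A → V A) ∧
    ∃ (A : Type) (_ : AiSemiring A), V A ∧ ¬ W A

/-- A limit variety: nonfinitely based, with all proper subvarieties finitely based. -/
def IsLimitVariety (V : AlgClass) : Prop :=
  IsVariety V ∧ ¬ IsFinitelyBased V ∧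
    ∀ W : AlgClass, IsProperSubvariety W V → IsFinitelyBased W

/-- `V` is combinatorial: it is generated by a finite algebra, and all subgroups of multiplicative
reducts of its members are trivial. -/
def IsCombinatorial (V : AlgClass) : Prop :=
  (∃ (S : Type) (_ : AiSemiring S), Finite S ∧
    ∀ (A : Type) [AiSemiring A], V A ↔ generatedVariety S A) ∧
  ∀ (A : Type) [AiSemiring A], V A →
    ∀ (G : Type) [Group G] (f : G →ₙ* A), Function.Injective f → Subsingleton G

/-! ### Flat semirings -/

/-- A flat semiring: there is a multiplicative zero, and it is the sum of any two distinct
elements. -/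
def IsFlat (S : Type*) [AiSemiring S] : Prop :=
  ∃ z : S, (∀ a : S, z * a = z ∧ a * z = z) ∧ ∀ a b : S, a ≠ b → a + b = z

/-- The flat extension of a cancellative semigroup `S`: a new multiplicative zero `0` is adjoined,
and `a + b = 0` for distinct `a`, `b`. -/
def FlatExt (S : Type*) : Type _ := WithZero S

namespace FlatExt

variable {S : Type*}

noncomputable instance [Semigroup S] : SemigroupWithZero (FlatExt S) :=
  inferInstanceAs (SemigroupWithZero (WithZero S))

open Classical in
noncomputable instance [Semigroup S] : Add (FlatExt S) :=
  ⟨fun a b => if a = b then a else 0⟩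

open Classical in
theorem add_def [Semigroup S] (a b : FlatExt S) : a + b = if a = b then a else 0 := rfl

theorem mul_left_cancel' [Semigroup S] [IsCancelMul S] {a b c : FlatExt S}
    (h : a * b = a * c) (h0 : a * b ≠ 0) : b = c := by
  rcases a with _ | a
  · exact absurd (zero_mul b) h0
  rcases b with _ | b
  · exact absurd (mul_zero _) h0
  rcases c with _ | c
  · exact absurd (h.trans (mul_zero _)) h0
  have h' : a * b = a * c := Option.some.inj h
  exact congrArg some (mul_left_cancel h')

theorem mul_right_cancel' [Semigroup S] [IsCancelMul S] {a b c : FlatExt S}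
    (h : b * a = c * a) (h0 : b * a ≠ 0) : b = c := by
  rcases a with _ | a
  · exact absurd (mul_zero b) h0
  rcases b with _ | b
  · exact absurd (zero_mul _) h0
  rcases c with _ | c
  · exact absurd (h.trans (zero_mul _)) h0
  have h' : b * a = c * a := Option.some.inj h
  exact congrArg some (mul_right_cancel h')

noncomputable instance [Semigroup S] [IsCancelMul S] : AiSemiring (FlatExt S) where
  add_assoc a b c := by
    simp only [add_def]
    by_cases h1 : a = b
    · subst h1; by_cases h2 : a = c <;> simp [h2] <;> exact fun h => h.symm
    · by_cases h2 : b = c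
      · subst h2; simp [h1]
      · by_cases h3 : 0 = c <;> by_cases h4 : a = 0 <;> simp [h1, h2, h3, h4] <;>
          exact fun h => h.symm
  add_comm a b := by
    simp only [add_def]; split_ifs <;> simp_all
  left_distrib a b c := by
    simp only [add_def]
    by_cases h : b = c
    · simp [h]
    · by_cases h' : a * b = a * c
      · by_cases h0 : a * b = 0
        · simp [h, ← h', h0]
        · exact absurd (mul_left_cancel' h' h0) h
      · simp [h, h']
  right_distrib b c a := by
    simp only [add_def]
    by_cases h : b = c
    · simp [h]
    · by_cases h' : b * a = c * a
      · by_cases h0 : b * a = 0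
        · simp [h, ← h', h0]
        · exact absurd (mul_right_cancel' h' h0) h
      · simp [h, h']
  add_idem a := by simp [add_def]
  nonempty := ⟨0⟩

end FlatExt

/-! ### The flat semiring `S_c(w)` -/

/-- The set `S_c(w)`, for a word `w` of the free commutative semigroup over `X` (that is, a nonempty
finite multiset): all nonempty subwords of `w` (`some u`) and a new symbol `0` (`none`). -/
def Sc {X : Type*} (w : Multiset X) : Type _ := Option {u : Multiset X // u ≠ 0 ∧ u ≤ w}

namespace Sc

variable {X : Type*} {w : Multiset X}

instance : Zero (Sc w) := ⟨none⟩

/-- A nonempty subword of `w`, as an element of `S_c(w)`. -/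
def word (u : Multiset X) (h : u ≠ 0 ∧ u ≤ w) : Sc w := some ⟨u, h⟩

theorem zero_or_word (a : Sc w) : a = 0 ∨ ∃ u h, a = word u h := by
  rcases a with _ | ⟨u, h⟩
  · exact Or.inl rfl
  · exact Or.inr ⟨u, h, rfl⟩

variable [DecidableEq X]

instance : DecidableEq (Sc w) :=
  inferInstanceAs (DecidableEq (Option {u : Multiset X // u ≠ 0 ∧ u ≤ w}))

/-- The multiset `u` as an element of `S_c(w)`: itself if it is a nonempty subword of `w`, and `0`
otherwise. -/
def ofWord (w u : Multiset X) : Sc w :=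
  if h : u ≠ 0 ∧ u ≤ w then word u h else 0

/-- The product of two subwords is their product in the free commutative semigroup (the sum of
multisets) if this is again a subword of `w`, and `0` otherwise. -/
instance : Mul (Sc w) :=
  ⟨fun a b => match a, b with
    | some u, some v => ofWord w (u.1 + v.1)
    | _, _ => none⟩

/-- The sum of two distinct elements is `0`. -/
instance : Add (Sc w) := ⟨fun a b => if a = b then a else 0⟩

theorem add_def (a b : Sc w) : a + b = if a = b then a else 0 := rfl

theorem zero_mul (a : Sc w) : 0 * a = 0 := rfl

theorem mul_zero (a : Sc w) : a * 0 = 0 := by rcases a with _ | a <;> rfl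

theorem word_mul_word (u v : Multiset X) (hu : u ≠ 0 ∧ u ≤ w) (hv : v ≠ 0 ∧ v ≤ w) :
    word u hu * word v hv = ofWord w (u + v) := rfl

theorem ofWord_of_not_le {u : Multiset X} (h : ¬ u ≤ w) : ofWord w u = 0 :=
  dif_neg fun h' => h h'.2

theorem ofWord_of_le {u : Multiset X} (h : u ≠ 0 ∧ u ≤ w) : ofWord w u = word u h := dif_pos h

theorem ofWord_mul (u v : Multiset X) (hu : u ≠ 0) (hv : v ≠ 0 ∧ v ≤ w) :
    ofWord w u * word v hv = ofWord w (u + v) := by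
  by_cases h : u ≤ w
  · rw [ofWord_of_le ⟨hu, h⟩, word_mul_word]
  · rw [ofWord_of_not_le h, zero_mul,
      ofWord_of_not_le fun h' => h ((Multiset.le_add_right u v).trans h')]

theorem mul_comm' (a b : Sc w) : a * b = b * a := by
  rcases zero_or_word a with rfl | ⟨u, hu, rfl⟩
  · rw [zero_mul, mul_zero]
  rcases zero_or_word b with rfl | ⟨v, hv, rfl⟩
  · rw [zero_mul, mul_zero]
  rw [word_mul_word, word_mul_word, add_comm]

theorem mul_assoc' (a b c : Sc w) : a * b * c = a * (b * c) := by
  rcases zero_or_word a with rfl | ⟨u, hu, rfl⟩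
  · simp only [zero_mul]
  rcases zero_or_word b with rfl | ⟨v, hv, rfl⟩
  · simp only [zero_mul, mul_zero]
  rcases zero_or_word c with rfl | ⟨t, ht, rfl⟩
  · simp only [mul_zero]
  have huv : u + v ≠ 0 := fun h => hu.1 (by simpa using (add_eq_zero.1 h).1)
  have hvt : v + t ≠ 0 := fun h => hv.1 (by simpa using (add_eq_zero.1 h).1)
  rw [word_mul_word, word_mul_word, mul_comm' (word u hu), ofWord_mul _ _ huv ht,
    ofWord_mul _ _ hvt hu]
  congr 1
  abel

theorem mul_left_cancel' {a b c : Sc w} (h : a * b = a * c) (h0 : a * b ≠ 0) : b = c := by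
  rcases zero_or_word a with rfl | ⟨u, hu, rfl⟩
  · exact absurd (zero_mul b) h0
  rcases zero_or_word b with rfl | ⟨v, hv, rfl⟩
  · exact absurd (mul_zero _) h0
  rcases zero_or_word c with rfl | ⟨t, ht, rfl⟩
  · exact absurd (h.trans (mul_zero _)) h0
  rw [word_mul_word] at h h0
  rw [word_mul_word] at h
  have h1 : u + v ≠ 0 ∧ u + v ≤ w := by
    by_contra hc; exact h0 (dif_neg hc)
  have h2 : u + t ≠ 0 ∧ u + t ≤ w := by
    by_contra hc; exact h0 (h.trans (dif_neg hc))
  rw [ofWord_of_le h1, ofWord_of_le h2] at h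
  have h3 : u + v = u + t := congrArg Subtype.val (Option.some.inj h)
  have h4 : v = t := add_left_cancel h3
  subst h4
  rfl

theorem left_distrib' (a b c : Sc w) : a * (b + c) = a * b + a * c := by
  simp only [add_def]
  by_cases h : b = c
  · simp [h]
  · by_cases h' : a * b = a * c
    · by_cases h0 : a * b = 0
      · simp [h, ← h', h0, mul_zero]
      · exact absurd (mul_left_cancel' h' h0) h
    · simp [h, h', mul_zero]

instance : AiSemiring (Sc w) where
  add_assoc a b c := by
    simp only [add_def]
    by_cases h1 : a = b
    · subst h1; by_cases h2 : a = c <;> simp [h2] <;> exact fun h => h.symm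
    · by_cases h2 : b = c
      · subst h2; simp [h1]
      · by_cases h3 : 0 = c <;> by_cases h4 : a = 0 <;> simp [h1, h2, h3, h4] <;>
          exact fun h => h.symm
  add_comm a b := by
    simp only [add_def]; split_ifs <;> simp_all
  mul_assoc := mul_assoc'
  left_distrib := left_distrib'
  right_distrib a b c := by
    rw [mul_comm', left_distrib', mul_comm' c a, mul_comm' c b]
  add_idem a := by simp [add_def]
  nonempty := ⟨0⟩

end Sc

/-- The word `abc`, a product of three distinct letters. -/
def abc : Multiset (Fin 3) := {0, 1, 2}

end AiSemiring

namespace AiSemiring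

/-! ### Terms and varieties -/

/-! Order an ai-semiring by a ≤ b iff a + b = b. Every member of V(S_c(abc)) is commutative and has
a largest element o, a multiplicative zero, to which all squares, all sums x + xy and all products
of four elements are equal. Hence it contains no nontrivial group: a group element is a product of
four, so it would be o. A flat extension of a group is excluded too, as it has two distinct
idempotents.

Proper subvarieties. If a linear word w takes a value other than o in such an algebra A, then S_c(w)
lies in every variety containing A (`Sc.mem_of_mon_ne_top`). So a subvariety omitting S_c(abc)
satisfies xyz = o; if it also omits S_c(ab) it satisfies xy = o; if it omits S_c(a) as well it is
trivial. Each remaining variety gets an explicit finite basis. For S_c(ab) the essential axiom is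
`pathIdentity`: for fixed p, it makes the components of the graph xy ≤ p complete bipartite, and the
proper 2-colourings of this graph supply enough assignments into S_c(ab)
(`IsNilTop.eval_add_eq_of_forall_ab`).

No finite basis. A linear 3-hypergraph defines a flat semiring, and vertex colourings with three
distinct colours on each edge map it to S_c(abc). Take the hypergraph dual to the prism over an
m-cycle, so that colourings are proper 3-edge-colourings of the prism. For odd m, two opposite rails
always get the same colour; this gives an identity of S_c(abc) that fails in the prism semiring
(`eval_prismTerm`, `eval_prismTerm_ne`). But fewer than m variables miss some index, and the prism
cut open there has so many colourings that identities in these variables carry over from S_c(abc)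
(`LinearHypergraph.eval_eq_of_colorings`, `satisfies_prism`). -/

theorem Term.map_eval {X A B : Type*} [AiSemiring A] [AiSemiring B] {f : A → B} (hf : IsHom f)
    (v : X → A) (t : Term X) : f (t.eval v) = t.eval (fun x => f (v x)) := by
  induction t with
  | var x => rfl
  | add s t hs ht => simp only [Term.eval, hf.1, hs, ht]
  | mul s t hs ht => simp only [Term.eval, hf.2, hs, ht]

theorem isHom_eval_pi {I : Type*} (A : I → Type*) [∀ i, AiSemiring (A i)] (i : I) :
    IsHom (fun a : ∀ i, A i => a i) :=
  ⟨fun _ _ => rfl, fun _ _ => rfl⟩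

theorem isVariety_models {X : Type} (s t : Term X) :
    IsVariety (fun A _ => ∀ v : X → A, s.eval v = t.eval v) where
  image A B _ _ f hf hs h v := by
    choose g hg using hs
    have := congrArg f (h fun x => g (v x))
    simpa only [Term.map_eval hf, hg] using this
  sub A B _ _ f hf hi h v := by
    apply hi
    rw [Term.map_eval hf, Term.map_eval hf]
    exact h _
  prod I A _ h v := by
    funext i
    have h1 := Term.map_eval (isHom_eval_pi A i) v
    exact (h1 s).trans ((h i _).trans (h1 t).symm)

theorem isVariety_generatedVariety (S : Type) [AiSemiring S] : IsVariety (generatedVariety S) where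
  image A B _ _ f hf hs h V hV hS := hV.image A B f hf hs (h V hV hS)
  sub A B _ _ f hf hi h V hV hS := hV.sub A B f hf hi (h V hV hS)
  prod I A _ h V hV hS := hV.prod I A fun i => h i V hV hS

theorem generatedVariety_self (S : Type) [AiSemiring S] : generatedVariety S S :=
  fun _ _ h => h

theorem generatedVariety.eval_eq {S A : Type} [AiSemiring S] [AiSemiring A]
    (h : generatedVariety S A) {X : Type} {s t : Term X}
    (hS : ∀ v : X → S, s.eval v = t.eval v) (v : X → A) : s.eval v = t.eval v :=
  h _ (isVariety_models s t) hS v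

theorem generatedVariety.satisfies {S A : Type} [AiSemiring S] [AiSemiring A]
    (h : generatedVariety S A) {e : Identity} (hS : Satisfies S e) : Satisfies A e :=
  h.eval_eq hS

/-- The subalgebra generated by the values of an assignment. -/
def EvalRange {X A : Type*} [AiSemiring A] (v : X → A) : Type _ :=
  {a : A // ∃ t : Term X, t.eval v = a}

instance {X A : Type*} [AiSemiring A] [Nonempty X] (v : X → A) : AiSemiring (EvalRange v) where
  add a b := ⟨a.1 + b.1, by
    obtain ⟨s, hs⟩ := a.2; obtain ⟨t, ht⟩ := b.2
    exact ⟨s.add t, by simp only [Term.eval, hs, ht]⟩⟩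
  mul a b := ⟨a.1 * b.1, by
    obtain ⟨s, hs⟩ := a.2; obtain ⟨t, ht⟩ := b.2
    exact ⟨s.mul t, by simp only [Term.eval, hs, ht]⟩⟩
  add_assoc a b c := Subtype.ext (add_assoc a.1 b.1 c.1)
  add_comm a b := Subtype.ext (add_comm a.1 b.1)
  mul_assoc a b c := Subtype.ext (mul_assoc a.1 b.1 c.1)
  left_distrib a b c := Subtype.ext (left_distrib a.1 b.1 c.1)
  right_distrib a b c := Subtype.ext (right_distrib a.1 b.1 c.1)
  add_idem a := Subtype.ext (add_idem a.1)
  nonempty := ⟨⟨v (Classical.arbitrary X), .var _, rfl⟩⟩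

/-- A variety contains each algebra `C` generated by `v₁` when the relations among the values of
some assignment `v₀` in a member of the variety also hold among the values of `v₁`. -/
theorem IsVariety.of_eval {V : AlgClass} (hV : IsVariety V) {X B C : Type} [Nonempty X]
    [AiSemiring B] [AiSemiring C] (hB : V B) (v₀ : X → B) (v₁ : X → C)
    (hgen : ∀ c, ∃ t : Term X, t.eval v₁ = c)
    (hker : ∀ s t : Term X, s.eval v₀ = t.eval v₀ → s.eval v₁ = t.eval v₁) : V C := by
  have hR : V (EvalRange v₀) :=
    hV.sub _ B Subtype.val ⟨fun _ _ => rfl, fun _ _ => rfl⟩ Subtype.val_injective hB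
  have hf (a : EvalRange v₀) (t : Term X) (ht : t.eval v₀ = a.1) :
      a.2.choose.eval v₁ = t.eval v₁ := hker _ _ (a.2.choose_spec.trans ht.symm)
  refine hV.image (EvalRange v₀) C (fun a => a.2.choose.eval v₁) ⟨fun a b => ?_, fun a b => ?_⟩
    (fun c => ?_) hR
  · refine hf (a + b) (a.2.choose.add b.2.choose) ?_
    change a.2.choose.eval v₀ + b.2.choose.eval v₀ = a.1 + b.1
    rw [a.2.choose_spec, b.2.choose_spec]
  · refine hf (a * b) (a.2.choose.mul b.2.choose) ?_
    change a.2.choose.eval v₀ * b.2.choose.eval v₀ = a.1 * b.1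
    rw [a.2.choose_spec, b.2.choose_spec]
  · obtain ⟨t, ht⟩ := hgen c
    exact ⟨⟨t.eval v₀, t, rfl⟩, (hf ⟨t.eval v₀, t, rfl⟩ t rfl).trans ht⟩

/-- Birkhoff's theorem for one generator: an algebra that satisfies the identities of a member of a
variety belongs to the variety. -/
theorem IsVariety.of_identities {V : AlgClass} (hV : IsVariety V) {S A : Type} [AiSemiring S]
    [AiSemiring A] (hS : V S)
    (h : ∀ s t : Term A, (∀ v : A → S, s.eval v = t.eval v) → s.eval id = t.eval id) : V A := by
  have : Nonempty A := AiSemiring.nonempty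
  -- In the power of `S` indexed by all assignments, the coordinate functions generate the
  -- relatively free algebra over `A`.
  refine hV.of_eval (hV.prod (A → S) (fun _ => S) fun _ => hS) (fun a v => v a) id
    (fun c => ⟨.var c, rfl⟩) fun s t hst => h s t fun v => ?_
  have h1 := Term.map_eval (isHom_eval_pi (fun _ : A → S => S) v) (fun a v => v a)
  exact (h1 s).symm.trans ((congrFun hst v).trans (h1 t))

/-! ### The order of an ai-semiring -/

section Order
variable {A : Type*} [AiSemiring A] {a b c : A}

/-- Here and below `a + b = b` is read as a ≤ b, and sums are least upper bounds. -/
theorem add_add_eq_iff : a + b + c = c ↔ a + c = c ∧ b + c = c := by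
  constructor
  · intro h
    constructor
    · rw [← h, add_assoc a b c, ← add_assoc a a, add_idem]
    · rw [← h, add_comm a b, add_assoc b a c, ← add_assoc b b, add_idem]
  · rintro ⟨h1, h2⟩
    rw [add_assoc, h2, h1]

theorem add_eq_trans (h : a + b = b) (h' : b + c = c) : a + c = c := by
  rw [← h', ← add_assoc, h]

theorem mul_add_mul_right (h : a + b = b) (c : A) : a * c + b * c = b * c := by
  rw [← add_mul, h]

theorem mul_add_mul_left (h : a + b = b) (c : A) : c * a + c * b = c * b := by
  rw [← mul_add, h]

end Order

/-! ### Commutative ai-semirings with a largest element, which is all squares -/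

/-- Multiplication is commutative, `o` is a multiplicative zero and the largest element, all squares
are `o`, and so is the sum of any element and a multiple of it. -/
structure IsNilTop (A : Type*) [AiSemiring A] (o : A) : Prop where
  mul_comm : ∀ x y : A, x * y = y * x
  mul_self : ∀ x : A, x * x = o
  add_top : ∀ x : A, x + o = o
  mul_top : ∀ x : A, x * o = o
  add_mul_self : ∀ x y : A, x + x * y = o

theorem _root_.WithOne.eq_one_or_coe {A : Type*} (z : WithOne A) : z = 1 ∨ ∃ a : A, z = a := by
  rcases z with _ | a
  · exact Or.inl rfl
  · exact Or.inr ⟨a, rfl⟩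

namespace IsNilTop
variable {A : Type*} [AiSemiring A] {o : A}

theorem top_mul (h : IsNilTop A o) (x : A) : o * x = o := by rw [h.mul_comm, h.mul_top]

theorem top_add (h : IsNilTop A o) (x : A) : o + x = o := by rw [add_comm, h.add_top]

theorem eq_top (h : IsNilTop A o) {x : A} (hx : o + x = x) : x = o := by rw [← hx, h.top_add]

/-- The product of a family of elements, in the monoid with an identity adjoined. -/
def mon {X : Type*} (h : IsNilTop A o) (g : X → A) (u : Multiset X) : WithOne A :=
  letI : CommSemigroup A := { mul_comm := h.mul_comm }
  (u.map fun x => (g x : WithOne A)).prod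

variable {X : Type*} (h : IsNilTop A o) (g : X → A)

theorem mon_add (u v : Multiset X) : h.mon g (u + v) = h.mon g u * h.mon g v := by
  simp only [mon, Multiset.map_add, Multiset.prod_add]

theorem mon_singleton (x : X) : h.mon g {x} = g x := by simp [mon]

theorem exists_mon_eq {u : Multiset X} (hu : u ≠ 0) : ∃ a : A, h.mon g u = a := by
  obtain ⟨x, hx⟩ := Multiset.exists_mem_of_ne_zero hu
  obtain ⟨v, rfl⟩ := Multiset.exists_cons_of_mem hx
  rw [← Multiset.singleton_add, mon_add, mon_singleton]
  rcases WithOne.eq_one_or_coe (h.mon g v) with hv | ⟨a, hv⟩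
  · exact ⟨g x, by rw [hv, mul_one]⟩
  · exact ⟨g x * a, by rw [hv, WithOne.coe_mul]⟩

theorem mon_eq_top_of_not_disjoint {u v : Multiset X} {x : X} (hu : x ∈ u) (hv : x ∈ v) :
    h.mon g u * h.mon g v = o := by
  have key (z : WithOne A) : (o : WithOne A) * z = o := by
    rcases WithOne.eq_one_or_coe z with rfl | ⟨a, rfl⟩
    · exact mul_one _
    · rw [← WithOne.coe_mul, h.top_mul]
  obtain ⟨s, rfl⟩ := Multiset.exists_cons_of_mem hu
  obtain ⟨t, rfl⟩ := Multiset.exists_cons_of_mem hv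
  rw [← mon_add]
  have : x ::ₘ s + x ::ₘ t = {x} + ({x} + (s + t)) := by
    simp only [← Multiset.singleton_add]; abel
  rw [this, mon_add, mon_add, ← mul_assoc, mon_singleton, ← WithOne.coe_mul, h.mul_self, key]

end IsNilTop

/-! ### The semirings `S_c(w)` -/

namespace Sc
variable {X : Type*} {w : Multiset X}

/-- The underlying multiset of an element of `S_c(w)`, which is empty for `0`. -/
def val : Sc w → Multiset X
  | none => 0
  | some u => u.1

@[simp] theorem val_zero : val (0 : Sc w) = 0 := rfl

@[simp] theorem val_word (u : Multiset X) (hu : u ≠ 0 ∧ u ≤ w) : val (word u hu) = u := rfl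

theorem val_eq_zero {x : Sc w} : val x = 0 ↔ x = 0 := by
  rcases zero_or_word x with rfl | ⟨u, hu, rfl⟩
  · simp
  · simp only [val_word, hu.1, false_iff]
    exact Option.some_ne_none _

theorem val_injective : Function.Injective (val : Sc w → Multiset X) := by
  intro x y hxy
  rcases zero_or_word x with rfl | ⟨u, hu, rfl⟩
  · exact (val_eq_zero.1 hxy.symm).symm
  rcases zero_or_word y with rfl | ⟨v, hv, rfl⟩
  · exact val_eq_zero.1 hxy
  · cases hxy; rfl

theorem val_le (x : Sc w) : val x ≤ w := by
  rcases zero_or_word x with rfl | ⟨u, hu, rfl⟩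
  · exact Multiset.zero_le _
  · exact hu.2

/-- A letter as an element of `S_c(w)`. -/
def letter (hw : ∀ x, x ∈ w) (x : X) : Sc w :=
  word {x} ⟨Multiset.singleton_ne_zero x, Multiset.singleton_le.2 (hw x)⟩

theorem letter_ne_zero (hw : ∀ x, x ∈ w) (x : X) : letter hw x ≠ 0 :=
  fun h => Multiset.singleton_ne_zero x (val_eq_zero.2 h)

variable [DecidableEq X]

theorem val_ofWord {u : Multiset X} (hu : u ≤ w) : val (ofWord w u) = u := by
  by_cases h : u = 0
  · subst h; exact val_eq_zero.2 (dif_neg fun h => h.1 rfl)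
  · rw [ofWord_of_le ⟨h, hu⟩]; rfl

theorem mul_ne_zero_iff {x y : Sc w} : x * y ≠ 0 ↔ x ≠ 0 ∧ y ≠ 0 ∧ val x + val y ≤ w := by
  rcases zero_or_word x with rfl | ⟨u, hu, rfl⟩
  · simp [zero_mul]
  rcases zero_or_word y with rfl | ⟨v, hv, rfl⟩
  · simp [mul_zero]
  rw [word_mul_word]
  have h1 : word u hu ≠ 0 := fun h => hu.1 (val_eq_zero.2 h)
  have h2 : word v hv ≠ 0 := fun h => hv.1 (val_eq_zero.2 h)
  simp only [ne_eq, h1, not_false_eq_true, h2, val_word, true_and]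
  constructor
  · intro h; by_contra h'; exact h (ofWord_of_not_le h')
  · intro h h'
    have := val_ofWord h
    rw [h', val_zero, eq_comm, add_eq_zero] at this
    exact hu.1 this.1

theorem val_mul {x y : Sc w} (h : x * y ≠ 0) : val (x * y) = val x + val y := by
  have h' := (mul_ne_zero_iff.1 h).2.2
  rcases zero_or_word x with rfl | ⟨u, hu, rfl⟩
  · exact absurd (zero_mul _) h
  rcases zero_or_word y with rfl | ⟨v, hv, rfl⟩
  · exact absurd (mul_zero _) h
  rw [word_mul_word]
  exact val_ofWord h'

theorem mul_eq_of_val_add {x y z : Sc w} (hx : x ≠ 0) (hy : y ≠ 0) (h : val x + val y = val z) :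
    x * y = z := by
  apply val_injective
  rw [val_mul (mul_ne_zero_iff.2 ⟨hx, hy, h ▸ val_le z⟩), h]

theorem add_self (x : Sc w) : x + x = x := if_pos rfl

theorem add_of_ne {x y : Sc w} (h : x ≠ y) : x + y = 0 := if_neg h

theorem zero_add (x : Sc w) : 0 + x = 0 := by
  by_cases h : 0 = x
  · rw [← h, add_self]
  · exact add_of_ne h

theorem add_zero (x : Sc w) : x + 0 = 0 := by rw [add_comm, zero_add]

theorem eq_of_add_ne_zero {x y : Sc w} (h : x + y ≠ 0) : x = y := by
  by_contra h'; exact h (add_of_ne h')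

/-- A linear word repeats no letter, so squares vanish. A nonzero x + xy would force x = xy, hence
an empty y. -/
theorem isNilTop (hw : w.Nodup) : IsNilTop (Sc w) 0 where
  mul_comm := mul_comm'
  mul_self x := by
    by_contra h
    obtain ⟨hx, -, hle⟩ := mul_ne_zero_iff.1 h
    obtain ⟨a, ha⟩ := Multiset.exists_mem_of_ne_zero (mt val_eq_zero.1 hx)
    exact Multiset.disjoint_left.1 (Multiset.nodup_add.1 (Multiset.nodup_of_le hle hw)).2.2 ha ha
  add_top := add_zero
  mul_top := mul_zero
  add_mul_self x y := by
    by_contra h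
    have h1 := eq_of_add_ne_zero h
    have h0 : x * y ≠ 0 := by rwa [← h1, add_self, h1] at h
    have h2 := val_mul h0
    rw [← h1, left_eq_add] at h2
    exact (mul_ne_zero_iff.1 h0).2.1 (val_eq_zero.1 h2)

theorem isFlat : IsFlat (Sc w) :=
  ⟨0, fun a => ⟨zero_mul a, mul_zero a⟩, fun _ _ => add_of_ne⟩

theorem exists_eval_letter [Nonempty X] (hw : ∀ x, x ∈ w) (hd : w.Nodup) (c : Sc w) :
    ∃ t : Term X, t.eval (letter hw) = c := by
  have hu (u : Multiset X) : ∀ hu : u ≠ 0 ∧ u ≤ w, ∃ t : Term X, t.eval (letter hw) = word u hu := by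
    induction u using Multiset.induction_on with
    | empty => intro h; exact absurd rfl h.1
    | cons x u ih =>
      intro h
      by_cases h0 : u = 0
      · subst h0
        exact ⟨.var x, rfl⟩
      · obtain ⟨t, ht⟩ := ih ⟨h0, (Multiset.le_cons_self u x).trans h.2⟩
        refine ⟨(Term.var x).mul t, ?_⟩
        simp only [Term.eval, ht]
        exact mul_eq_of_val_add (letter_ne_zero hw x) (fun h' => h0 (val_eq_zero.2 h'))
          (Multiset.singleton_add x u)
  rcases zero_or_word c with rfl | ⟨u, h, rfl⟩
  · let x := Classical.arbitrary X
    exact ⟨(Term.var x).mul (.var x), (isNilTop hd).mul_self _⟩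
  · exact hu u h

/-- `S_c(w)`, for a linear word `w`, belongs to the variety generated by each ai-semiring of the
appropriate sort in which `w` takes a value other than the largest element. -/
theorem mem_of_mon_ne_top {V : AlgClass} (hV : IsVariety V) {X : Type} [DecidableEq X] [Nonempty X]
    {w : Multiset X} (hw : ∀ x, x ∈ w) (hd : w.Nodup) {A : Type} [AiSemiring A] (hA : V A) {o : A}
    (h : IsNilTop A o) (g : X → A) {q : A} (hq : h.mon g w = q) (hqo : q ≠ o) : V (Sc w) := by
  -- `M` sends a subword to its value under `g`, and `0` to `o`. It is multiplicative, but need not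
  -- preserve sums.
  have hex (s : Sc w) : ∃ a : A, (s = 0 → a = o) ∧ (s ≠ 0 → h.mon g s.val = a) := by
    by_cases hs : s = 0
    · exact ⟨o, fun _ => rfl, fun h => absurd hs h⟩
    · obtain ⟨a, ha⟩ := h.exists_mon_eq g (mt val_eq_zero.1 hs)
      exact ⟨a, fun h => absurd h hs, fun _ => ha⟩
  choose M hM0 hM using hex
  replace hM0 := hM0 0 rfl
  have hmul (s t : Sc w) : M s * M t = M (s * t) := by
    by_cases hs : s = 0
    · rw [hs, zero_mul, hM0, h.top_mul]
    by_cases ht : t = 0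
    · rw [ht, mul_zero, hM0, h.mul_top]
    apply WithOne.coe_injective
    rw [WithOne.coe_mul, ← hM s hs, ← hM t ht]
    by_cases hst : s * t = 0
    · rw [hst, hM0]
      -- Disjoint subwords of the linear word `w` have a nonzero product. So there is a common
      -- letter, and its square is `o`.
      have h1 : ¬ Disjoint s.val t.val := by
        intro hdis
        refine mul_ne_zero_iff.2 ⟨hs, ht, ?_⟩ hst
        rw [Multiset.le_iff_subset (Multiset.nodup_add.2 ⟨Multiset.nodup_of_le s.val_le hd,
          Multiset.nodup_of_le t.val_le hd, hdis⟩)]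
        exact fun x _ => hw x
      rw [Multiset.disjoint_left] at h1
      push Not at h1
      obtain ⟨x, hx, hx'⟩ := h1
      exact h.mon_eq_top_of_not_disjoint g hx hx'
    · rw [← hM _ hst, val_mul hst, h.mon_add]
  have hw0 : w ≠ 0 := by
    rintro rfl
    exact Multiset.notMem_zero _ (hw (Classical.arbitrary X))
  obtain ⟨top, htop⟩ : ∃ top : Sc w, top.val = w := ⟨word w ⟨hw0, le_rfl⟩, rfl⟩
  have htop0 : top ≠ 0 := fun h => hw0 (by rw [← htop, h, val_zero])
  have hMtop : M top = q := by
    apply WithOne.coe_injective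
    rw [← hM top htop0, htop, hq]
  have hcompl (s : Sc w) (hs : s ≠ 0) (hs' : s ≠ top) : ∃ n, s * n = top := by
    obtain ⟨n, hn⟩ := Multiset.le_iff_exists_add.1 s.val_le
    have hn0 : n ≠ 0 := by
      rintro rfl
      exact hs' (val_injective (by rw [htop]; simpa using hn.symm))
    have hnw : n ≤ w := by rw [hn]; exact Multiset.le_add_left n _
    exact ⟨word n ⟨hn0, hnw⟩, mul_eq_of_val_add hs (fun h => hn0 (val_eq_zero.2 h))
      (by rw [htop]; exact hn.symm)⟩
  -- A proper subword has a value x with q = xy for some y, so x ≤ q would give q = x + xy = `o`.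
  have hK (s : Sc w) (hs : M s + q = q) : s = top := by
    by_cases hs0 : s = 0
    · rw [hs0, hM0] at hs
      exact absurd (h.eq_top hs) hqo
    by_contra hst
    obtain ⟨n, hn⟩ := hcompl s hs0 hst
    have hq' : q = M s * M n := by rw [hmul, hn, hMtop]
    rw [hq', h.add_mul_self, ← hq'] at hs
    exact hqo hs.symm
  have hle (t : Term X) (h0 : t.eval (letter hw) ≠ 0) : t.eval g = M (t.eval (letter hw)) := by
    induction t with
    | var x =>
      apply WithOne.coe_injective
      rw [← hM _ h0]
      exact (h.mon_singleton g x).symm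
    | add s t hs ht =>
      simp only [Term.eval] at h0 ⊢
      have h1 := eq_of_add_ne_zero h0
      rw [← h1, add_self] at h0 ⊢
      rw [hs h0, ht (h1 ▸ h0), ← h1, add_idem]
    | mul s t hs ht =>
      simp only [Term.eval] at h0 ⊢
      have h1 := mul_ne_zero_iff.1 h0
      rw [hs h1.1, ht h1.2.1, hmul]
  have hge (t : Term X) : ∃ s, M s + t.eval g = t.eval g := by
    induction t with
    | var x =>
      refine ⟨letter hw x, ?_⟩
      have := hle (.var x) (letter_ne_zero hw x)
      simp only [Term.eval] at this ⊢
      rw [← this, add_idem]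
    | add s t hs ht =>
      obtain ⟨a, ha⟩ := hs
      exact ⟨a, by simp only [Term.eval]; rw [← add_assoc, ha]⟩
    | mul s t hs ht =>
      obtain ⟨a, ha⟩ := hs
      obtain ⟨b, hb⟩ := ht
      refine ⟨a * b, ?_⟩
      rw [← hmul]
      exact add_eq_trans (mul_add_mul_right ha _) (mul_add_mul_left hb _)
  -- The extra factor `b` makes the induction work. In a product, one factor is first replaced by a
  -- smaller value `M u`; this shows that the other is nonzero at the letters, hence itself a value
  -- of `M`, and it can then play the role of `b`.
  have hmain (t : Term X) : (t.eval g + q = q → t.eval (letter hw) = top) ∧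
      ∀ b, t.eval g * M b + q = q → t.eval (letter hw) * b = top := by
    induction t with
    | var x =>
      have hx := hle (.var x) (letter_ne_zero hw x)
      rw [hx]
      exact ⟨hK _, fun b hb => hK _ (by rw [← hmul]; exact hb)⟩
    | add s t hs ht =>
      simp only [Term.eval]
      constructor
      · intro hst
        obtain ⟨h1, h2⟩ := add_add_eq_iff.1 hst
        rw [hs.1 h1, ht.1 h2, add_self]
      · intro b hst
        rw [add_mul] at hst
        obtain ⟨h1, h2⟩ := add_add_eq_iff.1 hst
        rw [add_mul, hs.2 b h1, ht.2 b h2, add_self]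
    | mul s t hs ht =>
      simp only [Term.eval]
      obtain ⟨u, hu⟩ := hge s
      constructor
      · intro hst
        have h1 : t.eval g * M u + q = q :=
          add_eq_trans (by rw [h.mul_comm]; exact mul_add_mul_right hu _) hst
        have h2 := ht.2 _ h1
        have h3 := hle t (mul_ne_zero_iff.1 (h2 ▸ htop0)).1
        exact hs.2 _ (by rw [← h3]; exact hst)
      · intro b hst
        have h1 : t.eval g * M (u * b) + q = q := by
          refine add_eq_trans ?_ hst
          rw [← hmul, ← mul_assoc, h.mul_comm _ (M u)]
          exact mul_add_mul_right (mul_add_mul_right hu _) _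
        have h2 := ht.2 _ h1
        have h3 := hle t (mul_ne_zero_iff.1 (h2 ▸ htop0)).1
        rw [mul_assoc]
        refine hs.2 _ ?_
        rw [← hmul, ← h3, ← mul_assoc]
        exact hst
  -- Multiplication by the complementary subword leads to `top`, where `hmain` applies; the
  -- complement is then cancelled.
  have hker (s t : Term X) (hst : s.eval g = t.eval g) (h0 : s.eval (letter hw) ≠ 0) :
      s.eval (letter hw) = t.eval (letter hw) := by
    have h1 := hle s h0
    by_cases h2 : s.eval (letter hw) = top
    · rw [h2, (hmain t).1]
      rw [← hst, h1, h2, hMtop, add_idem]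
    · obtain ⟨n, hn⟩ := hcompl _ h0 h2
      have h3 := (hmain t).2 n (by rw [← hst, h1, hmul, hn, hMtop, add_idem])
      rw [← hn, mul_comm', mul_comm' _ n] at h3
      exact (mul_left_cancel' h3 (by rw [h3, mul_comm', hn]; exact htop0)).symm
  refine hV.of_eval hA g (letter hw) (exists_eval_letter hw hd) fun s t hst => ?_
  by_cases h1 : s.eval (letter hw) = 0
  · by_cases h2 : t.eval (letter hw) = 0
    · rw [h1, h2]
    · exact (hker t s hst.symm h2).symm
  · exact hker s t hst h1

end Sc
/-! ### Finite bases -/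

theorem isFinitelyBased_of_list {V : AlgClass} (L : List Identity)
    (h : ∀ (A : Type) [AiSemiring A], V A ↔ ∀ e ∈ L, Satisfies A e) : IsFinitelyBased V := by
  classical
  exact ⟨L.toFinset, fun A _ => by simp only [List.mem_toFinset]; exact h A⟩

/-- The identities `xy ≈ yx`, `xx + y ≈ xx`, `xxy ≈ xx` and `x + xy ≈ xx`. -/
def nilTopIdentities : List Identity :=
  [((Term.var 0).mul (.var 1), (Term.var 1).mul (.var 0)),
   (((Term.var 0).mul (.var 0)).add (.var 1), (Term.var 0).mul (.var 0)),
   (((Term.var 0).mul (.var 0)).mul (.var 1), (Term.var 0).mul (.var 0)),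
   ((Term.var 0).add ((Term.var 0).mul (.var 1)), (Term.var 0).mul (.var 0))]

/-- The identity `xy ≈ xx`. -/
def nilTwoIdentity : Identity := ((Term.var 0).mul (.var 1), (Term.var 0).mul (.var 0))

/-- The identity `xyz ≈ xx`. -/
def nilThreeIdentity : Identity :=
  (((Term.var 0).mul (.var 1)).mul (.var 2), (Term.var 0).mul (.var 0))

/-- The identity `xyzt ≈ xx`. -/
def nilFourIdentity : Identity :=
  ((((Term.var 0).mul (.var 1)).mul (.var 2)).mul (.var 3), (Term.var 0).mul (.var 0))

/-- The identity `xy + yz + zt ≈ xy + yz + zt + xt`. -/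
def pathIdentity : Identity :=
  ((((Term.var 0).mul (.var 1)).add ((Term.var 1).mul (.var 2))).add ((Term.var 2).mul (.var 3)),
   ((((Term.var 0).mul (.var 1)).add ((Term.var 1).mul (.var 2))).add
      ((Term.var 2).mul (.var 3))).add ((Term.var 0).mul (.var 3)))

/-- The assignment of four values to the first four variables. -/
def assign {A : Type*} (x y z t : A) : ℕ → A
  | 0 => x
  | 1 => y
  | 2 => z
  | _ => t

section
variable {A : Type} [AiSemiring A] {o : A}

theorem satisfies_nilTopIdentities :
    (∀ e ∈ nilTopIdentities, Satisfies A e) ↔ ∃ o : A, IsNilTop A o := by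
  simp only [nilTopIdentities, List.forall_mem_cons, Satisfies, Term.eval]
  constructor
  · rintro ⟨h1, h2, h3, h4, -⟩
    obtain ⟨x₀⟩ := AiSemiring.nonempty (S := A)
    -- Each square is a largest element, so all squares coincide.
    have hsq (x : A) : x * x = x₀ * x₀ := by
      have e1 := h2 (assign x (x₀ * x₀) x x)
      have e2 := h2 (assign x₀ (x * x) x x)
      simp only [assign] at e1 e2
      rw [← e1, add_comm, e2]
    refine ⟨x₀ * x₀, fun x y => h1 (assign x y x x), hsq, fun x => ?_, fun x => ?_, fun x y => ?_⟩
    · rw [add_comm]; exact h2 (assign x₀ x x x)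
    · exact (h1 (assign x (x₀ * x₀) x x)).trans (h3 (assign x₀ x x x))
    · exact (h4 (assign x y x x)).trans (hsq x)
  · rintro ⟨o, h⟩
    refine ⟨fun v => h.mul_comm _ _, fun v => ?_, fun v => ?_, fun v => ?_, fun _ h => by simp at h⟩
    · rw [h.mul_self, h.top_add]
    · rw [h.mul_self, h.top_mul]
    · rw [h.mul_self, h.add_mul_self]

theorem IsNilTop.satisfies_nilTwoIdentity (h : IsNilTop A o) :
    Satisfies A nilTwoIdentity ↔ ∀ x y : A, x * y = o := by
  refine ⟨fun hA x y => (hA (assign x y x x)).trans (h.mul_self _), fun hA v => ?_⟩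
  exact (hA _ _).trans (h.mul_self _).symm

theorem IsNilTop.satisfies_nilThreeIdentity (h : IsNilTop A o) :
    Satisfies A nilThreeIdentity ↔ ∀ x y z : A, x * y * z = o := by
  refine ⟨fun hA x y z => (hA (assign x y z x)).trans (h.mul_self _), fun hA v => ?_⟩
  exact (hA _ _ _).trans (h.mul_self _).symm

theorem IsNilTop.satisfies_nilFourIdentity (h : IsNilTop A o) :
    Satisfies A nilFourIdentity ↔ ∀ x y z t : A, x * y * z * t = o := by
  refine ⟨fun hA x y z t => (hA (assign x y z t)).trans (h.mul_self _), fun hA v => ?_⟩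
  exact (hA _ _ _ _).trans (h.mul_self _).symm

theorem satisfies_pathIdentity : Satisfies A pathIdentity ↔ ∀ x y z t b : A,
    x * y + b = b → y * z + b = b → z * t + b = b → x * t + b = b := by
  constructor
  · intro hA x y z t b h1 h2 h3
    have h4 := hA (assign x y z t)
    simp only [pathIdentity, Term.eval, assign] at h4
    have h5 : x * y + y * z + z * t + b = b :=
      add_add_eq_iff.2 ⟨add_add_eq_iff.2 ⟨h1, h2⟩, h3⟩
    rw [h4] at h5
    exact (add_add_eq_iff.1 h5).2
  · intro hA v
    simp only [pathIdentity, Term.eval]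
    have h0 := add_idem (v 0 * v 1 + v 1 * v 2 + v 2 * v 3)
    obtain ⟨h1, h3⟩ := add_add_eq_iff.1 h0
    obtain ⟨h1, h2⟩ := add_add_eq_iff.1 h1
    rw [add_comm _ (v 0 * v 3)]
    exact (hA _ _ _ _ _ h1 h2 h3).symm

end

/-- For nonzero b the three products are equal to b. Cancelling y in xy = yz gives x = z, so xt =
zt. -/
theorem Sc.satisfies_pathIdentity {X : Type} [DecidableEq X] (w : Multiset X) :
    Satisfies (Sc w) pathIdentity := by
  rw [AiSemiring.satisfies_pathIdentity]
  intro x y z t b h1 h2 h3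
  by_cases hb : b = 0
  · rw [hb, Sc.add_zero]
  have h1' := Sc.eq_of_add_ne_zero (h1 ▸ hb)
  have h2' := Sc.eq_of_add_ne_zero (h2 ▸ hb)
  have h12 : y * x = y * z := by rw [Sc.mul_comm' y x, h1', h2']
  have hxz : x = z := Sc.mul_left_cancel' h12 (by rw [h12, h2']; exact hb)
  rw [hxz]
  exact h3

/-! ### Bipartite relations without induced paths with four vertices -/

/-- A symmetric irreflexive relation, in which the ends of a walk of length three are related, has a
proper 2-colouring with prescribed values at two points in different connected components. -/
theorem exists_bool_coloring {A : Type*} (R : A → A → Prop) (hs : ∀ x y, R x y → R y x)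
    (hi : ∀ x, ¬ R x x) (hp : ∀ x y z t, R x y → R y z → R z t → R x t) (x₀ y₀ : A)
    (hne : x₀ ≠ y₀) (h1 : ¬ R x₀ y₀) (h2 : ∀ z, R x₀ z → ¬ R y₀ z) (b : Bool) :
    ∃ f : A → Bool, (∀ x y, R x y → f x ≠ f y) ∧ f x₀ = true ∧ f y₀ = b := by
  classical
  -- This is connectedness: walks of length three shorten to edges, so components have diameter at
  -- most two.
  let s : Setoid A :=
    { r := fun x y => x = y ∨ R x y ∨ ∃ z, R x z ∧ R z y
      iseqv :=
        { refl := fun x => Or.inl rfl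
          symm := by
            rintro x y (h | h | ⟨z, h, h'⟩)
            · exact Or.inl h.symm
            · exact Or.inr (Or.inl (hs _ _ h))
            · exact Or.inr (Or.inr ⟨z, hs _ _ h', hs _ _ h⟩)
          trans := by
            rintro x y z (rfl | h | ⟨u, h, h'⟩) (rfl | k | ⟨v, k, k'⟩)
            · exact Or.inl rfl
            · exact Or.inr (Or.inl k)
            · exact Or.inr (Or.inr ⟨v, k, k'⟩)
            · exact Or.inr (Or.inl h)
            · exact Or.inr (Or.inr ⟨_, h, k⟩)
            · exact Or.inr (Or.inl (hp _ _ _ _ h k k'))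
            · exact Or.inr (Or.inr ⟨u, h, h'⟩)
            · exact Or.inr (Or.inl (hp _ _ _ _ h h' k))
            · exact Or.inr (Or.inr ⟨v, hp _ _ _ _ h h' k, k'⟩) } }
  let rep : A → A := fun x => (Quotient.mk s x).out
  have hrep (x : A) : s.r (rep x) x := Quotient.mk_out (s := s) x
  have hrep' {x y : A} (h : R x y) : rep x = rep y :=
    congrArg Quotient.out (Quotient.sound (s := s) (Or.inr (Or.inl h)))
  -- The colour records adjacency to the chosen representative of the component. Two adjacent points
  -- cannot both be adjacent to it, since that would close a walk of length three.
  let f₀ : A → Bool := fun x => decide (R x (rep x))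
  have hf₀ (x y : A) (h : R x y) : f₀ x ≠ f₀ y := by
    have hor : R x (rep x) ∨ R y (rep x) := by
      rcases hrep x with h' | h' | ⟨z, h', h''⟩
      · exact Or.inr (by rw [h']; exact hs _ _ h)
      · exact Or.inl (hs _ _ h')
      · exact Or.inr (hs _ _ (hp _ _ _ _ h' h'' h))
    have hand : ¬ (R x (rep x) ∧ R y (rep x)) := fun ⟨ha, hb⟩ =>
      hi x (hp _ _ _ _ ha (hs _ _ hb) (hs _ _ h))
    simp only [f₀, ← hrep' h, ne_eq, decide_eq_decide]
    tauto
  -- Whole components are flipped to prescribe the colours of `x₀` and `y₀`.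
  let g : Quotient s → Bool := fun c => if c = Quotient.mk s x₀ then !(f₀ x₀) else xor (f₀ y₀) b
  refine ⟨fun x => xor (f₀ x) (g (Quotient.mk s x)), fun x y h => ?_, ?_, ?_⟩
  · have h3 : (Quotient.mk s x) = Quotient.mk s y := Quotient.sound (Or.inr (Or.inl h))
    have h4 := hf₀ x y h
    simp only [h3, ne_eq]
    simpa using h4
  · simp [g]
  · have h3 : Quotient.mk s y₀ ≠ Quotient.mk s x₀ := by
      intro h
      rcases Quotient.exact h with h' | h' | ⟨z, h', h''⟩
      · exact hne h'.symm
      · exact h1 (hs _ _ h')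
      · exact h2 z (hs _ _ h'') h'
    simp [g, h3]

/-! ### The variety generated by `S_c(ab)` -/

/-- The word `ab`, a product of two distinct letters. -/
def ab : Multiset (Fin 2) := {0, 1}

namespace Sc

/-- The elements `a` and `b` of `S_c(ab)`. -/
def color : Bool → Sc ab
  | true => ofWord ab {0}
  | false => ofWord ab {1}

theorem color_ne_zero (i : Bool) : color i ≠ 0 := by revert i; decide

theorem color_injective : Function.Injective color := by unfold Function.Injective; decide

theorem color_ne_top (i : Bool) : color i ≠ ofWord ab ab := by revert i; decide

theorem top_ne_zero : ofWord ab ab ≠ 0 := by decide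

theorem color_mul_color (i j : Bool) : color i * color j = if i = j then 0 else ofWord ab ab := by
  revert i j; decide

theorem top_mul_top : ofWord ab ab * ofWord ab ab = 0 := by decide

theorem top_mul_color (i : Bool) : ofWord ab ab * color i = 0 := by revert i; decide

end Sc

/-- The assignment defined by a 2-colouring of the elements `e` such that `e * g ≤ p` for some `g`. -/
noncomputable def colorVal {A : Type*} [AiSemiring A] (p : A) (f : A → Bool) (e : A) : Sc ab :=
  open Classical in
  if e + p = p then Sc.ofWord ab ab else if ∃ g, e * g + p = p then Sc.color (f e) else 0

/-- Let p be the value of s, and join x and y when xy ≤ p. Under the assignment given by a proper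
2-colouring, each term takes the colour of its value in A if that colour is nonzero (`heval`).
Conversely, a term that is nonzero under all these assignments has a value with nonzero colour
(`hconv`). As s takes the value ab under all of them, so does t, whence t ≤ p. -/
theorem IsNilTop.eval_add_eq_of_forall_ab {A : Type} [AiSemiring A] {o : A} (h : IsNilTop A o)
    (h3 : ∀ x y z : A, x * y * z = o) (hpath : Satisfies A pathIdentity) (s t : Term A)
    (hst : ∀ v : A → Sc ab, s.eval v = t.eval v) : t.eval id + s.eval id = s.eval id := by
  set p := s.eval id with hp
  by_cases hpo : p = o
  · rw [hpo, h.add_top]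
  rw [satisfies_pathIdentity] at hpath
  have hop : ¬ o + p = p := fun h' => hpo (h.eq_top h')
  have hsymm (x y : A) (hxy : x * y + p = p) : y * x + p = p := by rwa [h.mul_comm]
  have hirr (x : A) : ¬ x * x + p = p := by rw [h.mul_self]; exact hop
  have hdisj {x y : A} (hx : x + p = p) : ¬ x * y + p = p := fun hxy =>
    hop (by rw [← h.add_mul_self x y]; exact add_add_eq_iff.2 ⟨hx, hxy⟩)
  have hvtop {f : A → Bool} {e : A} (he : e + p = p) : colorVal p f e = Sc.ofWord ab ab :=
    if_pos he
  have hvcol {f : A → Bool} {e g : A} (he : e * g + p = p) : colorVal p f e = Sc.color (f e) := by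
    rw [colorVal, if_neg fun h' => hdisj h' he, if_pos ⟨g, he⟩]
  have hvne {f : A → Bool} {e : A} (he : colorVal p f e ≠ 0) :
      e + p = p ∨ ∃ g, e * g + p = p := by
    by_contra h'
    push Not at h'
    refine he ?_
    rw [colorVal, if_neg h'.1, if_neg]
    rintro ⟨g, hg⟩
    exact h'.2 g hg
  have heval (f : A → Bool) (hf : ∀ x y, x * y + p = p → f x ≠ f y) (r : Term A)
      (hr : colorVal p f (r.eval id) ≠ 0) :
      r.eval (colorVal p f) = colorVal p f (r.eval id) := by
    induction r with
    | var x => rfl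
    | add r₁ r₂ ih₁ ih₂ =>
      simp only [Term.eval] at hr ⊢
      rcases hvne hr with h1 | ⟨g, h1⟩
      · obtain ⟨ha, hb⟩ := add_add_eq_iff.1 h1
        rw [hvtop h1]
        rw [hvtop ha] at ih₁
        rw [hvtop hb] at ih₂
        rw [ih₁ Sc.top_ne_zero, ih₂ Sc.top_ne_zero, Sc.add_self]
      · have h2 := h1
        rw [add_mul] at h2
        obtain ⟨ha, hb⟩ := add_add_eq_iff.1 h2
        have hcol (c : A) (hc : c * g + p = p) : colorVal p f c = Sc.color (!(f g)) := by
          rw [hvcol hc]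
          exact congrArg _ (Bool.eq_not.2 (hf _ _ hc))
        rw [hcol _ h1]
        rw [hcol _ ha] at ih₁
        rw [hcol _ hb] at ih₂
        rw [ih₁ (Sc.color_ne_zero _), ih₂ (Sc.color_ne_zero _), Sc.add_self]
    | mul r₁ r₂ ih₁ ih₂ =>
      simp only [Term.eval] at hr ⊢
      rcases hvne hr with h1 | ⟨g, h1⟩
      · rw [hvtop h1]
        rw [hvcol h1] at ih₁
        rw [hvcol (hsymm _ _ h1)] at ih₂
        rw [ih₁ (Sc.color_ne_zero _), ih₂ (Sc.color_ne_zero _), Sc.color_mul_color,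
          if_neg (hf _ _ h1)]
      · rw [h3] at h1
        exact absurd h1 hop
  have hcoloring (x y : A) (hne : x ≠ y) (h1 : ¬ x * y + p = p)
      (h2 : ∀ z, x * z + p = p → ¬ y * z + p = p) (b : Bool) :=
    exists_bool_coloring (fun x y => x * y + p = p) hsymm hirr
      (fun x y z t => hpath x y z t p) x y hne h1 h2 b
  -- Any proper colouring will do; the isolated point `o` serves as one of the two prescribed
  -- points.
  obtain ⟨f₁, hf₁⟩ : ∃ f : A → Bool, ∀ x y, x * y + p = p → f x ≠ f y := by
    by_cases hpo' : ∃ x : A, x ≠ o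
    · obtain ⟨x, hx⟩ := hpo'
      have ho (z : A) : ¬ o * z + p = p := by rw [h.top_mul]; exact hop
      obtain ⟨f, hf, -⟩ := hcoloring o x (Ne.symm hx) (ho x) (fun z hz => absurd hz (ho z)) true
      exact ⟨f, hf⟩
    · exact absurd ⟨p, hpo⟩ hpo'
  have hconv (r : Term A) (hr : ∀ f : A → Bool, (∀ x y, x * y + p = p → f x ≠ f y) →
      r.eval (colorVal p f) ≠ 0) : r.eval id + p = p ∨ ∃ g, r.eval id * g + p = p := by
    have hne {r : Term A} (hr : r.eval id + p = p ∨ ∃ g, r.eval id * g + p = p) (f : A → Bool) :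
        colorVal p f (r.eval id) ≠ 0 := by
      rcases hr with hr | ⟨g, hr⟩
      · rw [hvtop hr]; exact Sc.top_ne_zero
      · rw [hvcol hr]; exact Sc.color_ne_zero _
    induction r with
    | var x => exact hvne (hr f₁ hf₁)
    | add r₁ r₂ ih₁ ih₂ =>
      simp only [Term.eval] at hr ⊢
      replace ih₁ := ih₁ fun f hf h0 => hr f hf (by rw [h0, Sc.zero_add])
      replace ih₂ := ih₂ fun f hf h0 => hr f hf (by rw [h0, Sc.add_zero])
      have heq (f : A → Bool) (hf : ∀ x y, x * y + p = p → f x ≠ f y) :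
          colorVal p f (r₁.eval id) = colorVal p f (r₂.eval id) := by
        rw [← heval f hf r₁ (hne ih₁ f), ← heval f hf r₂ (hne ih₂ f)]
        exact Sc.eq_of_add_ne_zero (hr f hf)
      rcases ih₁ with h1 | ⟨g, h1⟩
      · rcases ih₂ with h2 | ⟨g', h2⟩
        · exact Or.inl (add_add_eq_iff.2 ⟨h1, h2⟩)
        · have := heq f₁ hf₁
          rw [hvtop h1, hvcol h2] at this
          exact absurd this.symm (Sc.color_ne_top _)
      · rcases ih₂ with h2 | ⟨g', h2⟩
        · have := heq f₁ hf₁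
          rw [hvtop h2, hvcol h1] at this
          exact absurd this (Sc.color_ne_top _)
        · right
          -- Without a common neighbour the two values are adjacent or in different components, and
          -- some colouring tells them apart.
          by_contra hcon
          push Not at hcon
          have hnc (z : A) (hz : r₁.eval id * z + p = p) : ¬ r₂.eval id * z + p = p := fun hz' =>
            hcon z (by rw [add_mul]; exact add_add_eq_iff.2 ⟨hz, hz'⟩)
          have hna : ¬ r₁.eval id * r₂.eval id + p = p := by
            intro hz
            have := heq f₁ hf₁
            rw [hvcol h1, hvcol h2] at this
            exact hf₁ _ _ hz (Sc.color_injective this)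
          have hnn : r₁.eval id ≠ r₂.eval id := fun hz => hnc g h1 (hz ▸ h1)
          obtain ⟨f, hf, hf1, hf2⟩ := hcoloring _ _ hnn hna hnc false
          have := heq f hf
          rw [hvcol h1, hvcol h2, hf1, hf2] at this
          exact absurd (Sc.color_injective this) (by decide)
    | mul r₁ r₂ ih₁ ih₂ =>
      simp only [Term.eval] at hr ⊢
      replace ih₁ := ih₁ fun f hf h0 => hr f hf (by rw [h0, Sc.zero_mul])
      replace ih₂ := ih₂ fun f hf h0 => hr f hf (by rw [h0, Sc.mul_zero])
      have hprod (f : A → Bool) (hf : ∀ x y, x * y + p = p → f x ≠ f y) :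
          colorVal p f (r₁.eval id) * colorVal p f (r₂.eval id) ≠ 0 := by
        rw [← heval f hf r₁ (hne ih₁ f), ← heval f hf r₂ (hne ih₂ f)]
        exact hr f hf
      left
      by_contra hcon
      rcases ih₁ with h1 | ⟨g, h1⟩
      · rcases ih₂ with h2 | ⟨g', h2⟩
        · exact hprod f₁ hf₁ (by rw [hvtop h1, hvtop h2, Sc.top_mul_top])
        · exact hprod f₁ hf₁ (by rw [hvtop h1, hvcol h2, Sc.top_mul_color])
      · rcases ih₂ with h2 | ⟨g', h2⟩
        · exact hprod f₁ hf₁ (by rw [hvtop h2, hvcol h1, Sc.mul_comm', Sc.top_mul_color])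
        · obtain ⟨f, hf, hf1⟩ : ∃ f : A → Bool, (∀ x y, x * y + p = p → f x ≠ f y) ∧
              f (r₁.eval id) = f (r₂.eval id) := by
            by_cases hnn : r₁.eval id = r₂.eval id
            · exact ⟨f₁, hf₁, by rw [hnn]⟩
            by_cases hnc : ∃ z, r₁.eval id * z + p = p ∧ r₂.eval id * z + p = p
            · obtain ⟨z, hz1, hz2⟩ := hnc
              exact ⟨f₁, hf₁, by rw [Bool.eq_not.2 (hf₁ _ _ hz1), Bool.eq_not.2 (hf₁ _ _ hz2)]⟩
            · push Not at hnc
              obtain ⟨f, hf, hf1, hf2⟩ := hcoloring _ _ hnn hcon hnc true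
              exact ⟨f, hf, hf1.trans hf2.symm⟩
          exact hprod f hf (by rw [hvcol h1, hvcol h2, Sc.color_mul_color, if_pos hf1])
  have hs (f : A → Bool) (hf : ∀ x y, x * y + p = p → f x ≠ f y) :
      s.eval (colorVal p f) = Sc.ofWord ab ab := by
    have hpp : colorVal p f (s.eval id) = Sc.ofWord ab ab := hvtop (add_idem p)
    rw [heval f hf s (by rw [hpp]; exact Sc.top_ne_zero), hpp]
  have ht (f : A → Bool) (hf : ∀ x y, x * y + p = p → f x ≠ f y) :
      t.eval (colorVal p f) = Sc.ofWord ab ab := by rw [← hst, hs f hf]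
  rcases hconv t fun f hf => by rw [ht f hf]; exact Sc.top_ne_zero with h1 | ⟨g, h1⟩
  · exact h1
  · have h2 : colorVal p f₁ (t.eval id) = Sc.color (f₁ (t.eval id)) := hvcol h1
    have h4 := heval f₁ hf₁ t (by rw [h2]; exact Sc.color_ne_zero _)
    rw [ht f₁ hf₁, h2] at h4
    exact absurd h4.symm (Sc.color_ne_top _)

theorem IsNilTop.mem_of_ab {V : AlgClass} (hV : IsVariety V) (hS : V (Sc ab)) {A : Type}
    [AiSemiring A] {o : A} (h : IsNilTop A o) (h3 : ∀ x y z : A, x * y * z = o)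
    (hpath : Satisfies A pathIdentity) : V A := by
  refine hV.of_identities hS fun s t hst => ?_
  rw [← h.eval_add_eq_of_forall_ab h3 hpath t s fun v => (hst v).symm, add_comm,
    h.eval_add_eq_of_forall_ab h3 hpath s t hst]

/-! ### The variety generated by `S_c(a)` -/

/-- The word with a single letter. -/
def single : Multiset (Fin 1) := {0}

/-- All products are trivial on both sides, so the indicator of the elements below p is the only
assignment needed. -/
theorem IsNilTop.eval_add_eq_of_forall_single {A : Type} [AiSemiring A] {o : A} (h : IsNilTop A o)
    (h2 : ∀ x y : A, x * y = o) (s t : Term A)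
    (hst : ∀ v : A → Sc single, s.eval v = t.eval v) : t.eval id + s.eval id = s.eval id := by
  classical
  set p := s.eval id with hp
  by_cases hpo : p = o
  · rw [hpo, h.add_top]
  have hne : Sc.ofWord single single ≠ 0 := by decide
  have hmul (x y : Sc single) : x * y = 0 := by
    by_contra hxy
    obtain ⟨hx, hy, hle⟩ := Sc.mul_ne_zero_iff.1 hxy
    have h1 := Multiset.card_le_card hle
    rw [Multiset.card_add] at h1
    have h2 := Multiset.card_pos.2 (mt Sc.val_eq_zero.1 hx)
    have h3 := Multiset.card_pos.2 (mt Sc.val_eq_zero.1 hy)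
    have h4 : Multiset.card single = 1 := rfl
    omega
  let v : A → Sc single := fun e => if e + p = p then Sc.ofWord single single else 0
  have hv (r : Term A) : r.eval v = if r.eval id + p = p then Sc.ofWord single single else 0 := by
    induction r with
    | var x => rfl
    | add r₁ r₂ ih₁ ih₂ =>
      simp only [Term.eval, ih₁, ih₂, add_add_eq_iff]
      by_cases h1 : r₁.eval id + p = p <;> by_cases h2 : r₂.eval id + p = p <;>
        simp [h1, h2, Sc.add_self, Sc.add_zero, Sc.zero_add]
    | mul r₁ r₂ ih₁ ih₂ =>
      have hn : ¬ (r₁.mul r₂).eval id + p = p := by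
        simp only [Term.eval, h2]
        exact fun h' => hpo (h.eq_top h')
      rw [if_neg hn]
      exact hmul _ _
  have h1 := hst v
  rw [hv, hv, ← hp, if_pos (add_idem p)] at h1
  by_contra h'
  rw [if_neg h'] at h1
  exact hne h1

theorem IsNilTop.mem_of_single {V : AlgClass} (hV : IsVariety V) (hS : V (Sc single)) {A : Type}
    [AiSemiring A] {o : A} (h : IsNilTop A o) (h2 : ∀ x y : A, x * y = o) : V A := by
  refine hV.of_identities hS fun s t hst => ?_
  rw [← h.eval_add_eq_of_forall_single h2 t s fun v => (hst v).symm, add_comm,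
    h.eval_add_eq_of_forall_single h2 s t hst]

theorem IsVariety.mem_of_subsingleton {V : AlgClass} (hV : IsVariety V) {A : Type} [AiSemiring A]
    [Subsingleton A] : V A :=
  hV.sub A (∀ i : Empty, (fun _ => A) i) (fun a _ => a) ⟨fun _ _ => rfl, fun _ _ => rfl⟩
    (fun _ _ _ => Subsingleton.elim _ _) (hV.prod Empty (fun _ => A) fun i => i.elim)

/-! ### The proper subvarieties of the variety generated by `S_c(abc)` -/

theorem nodup_abc : abc.Nodup := by decide

theorem mem_abc (x : Fin 3) : x ∈ abc := by revert x; decide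

theorem exists_isNilTop_of_generatedVariety {A : Type} [AiSemiring A]
    (hA : generatedVariety (Sc abc) A) : ∃ o : A, IsNilTop A o :=
  satisfies_nilTopIdentities.1 fun e he =>
    hA.satisfies (satisfies_nilTopIdentities.2 ⟨0, Sc.isNilTop nodup_abc⟩ e he)

theorem satisfies_nilFourIdentity_abc : Satisfies (Sc abc) nilFourIdentity := by
  rw [(Sc.isNilTop nodup_abc).satisfies_nilFourIdentity]
  intro x y z t
  by_contra h1
  have h2 := (Sc.mul_ne_zero_iff.1 h1)
  have h3 := (Sc.mul_ne_zero_iff.1 h2.1)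
  have h4 := (Sc.mul_ne_zero_iff.1 h3.1)
  have h5 := Multiset.card_le_card h2.2.2
  rw [Sc.val_mul h2.1, Sc.val_mul h3.1] at h5
  simp only [Multiset.card_add] at h5
  have := Multiset.card_pos.2 (mt Sc.val_eq_zero.1 h2.2.1)
  have := Multiset.card_pos.2 (mt Sc.val_eq_zero.1 h3.2.1)
  have := Multiset.card_pos.2 (mt Sc.val_eq_zero.1 h4.1)
  have := Multiset.card_pos.2 (mt Sc.val_eq_zero.1 h4.2.1)
  have : Multiset.card abc = 3 := rfl
  omega

/-- The subvariety is generated by S_c(ab), generated by S_c(a), or trivial, according to which of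
these semirings it contains. -/
theorem isFinitelyBased_of_subvariety {W : AlgClass} (hW : IsVariety W)
    (hsub : ∀ (A : Type) [AiSemiring A], W A → generatedVariety (Sc abc) A)
    (hS : ¬ W (Sc abc)) : IsFinitelyBased W := by
  have h3 {A : Type} [AiSemiring A] (hA : W A) {o : A} (h : IsNilTop A o) (x y z : A) :
      x * y * z = o := by
    by_contra hne
    refine hS (Sc.mem_of_mon_ne_top hW mem_abc nodup_abc hA h ![x, y, z] (q := x * y * z) ?_ hne)
    have h1 : abc = {0} + {1} + {2} := rfl
    rw [h1, h.mon_add, h.mon_add, h.mon_singleton, h.mon_singleton, h.mon_singleton]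
    rfl
  have htop {A : Type} [AiSemiring A] (hA : W A) := exists_isNilTop_of_generatedVariety (hsub A hA)
  have hids {A : Type} [AiSemiring A] (hA : W A) := satisfies_nilTopIdentities.2 (htop hA)
  by_cases hab : W (Sc ab)
  · refine isFinitelyBased_of_list (nilThreeIdentity :: pathIdentity :: nilTopIdentities)
      fun A _ => ?_
    rw [List.forall_mem_cons, List.forall_mem_cons]
    constructor
    · intro hA
      obtain ⟨o, h⟩ := htop hA
      exact ⟨h.satisfies_nilThreeIdentity.2 (h3 hA h),
        (hsub A hA).satisfies (Sc.satisfies_pathIdentity abc), hids hA⟩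
    · rintro ⟨h1, h2, h4⟩
      obtain ⟨o, h⟩ := satisfies_nilTopIdentities.1 h4
      exact h.mem_of_ab hW hab (h.satisfies_nilThreeIdentity.1 h1) h2
  have h2 {A : Type} [AiSemiring A] (hA : W A) {o : A} (h : IsNilTop A o) (x y : A) :
      x * y = o := by
    by_contra hne
    refine hab (Sc.mem_of_mon_ne_top hW (by unfold ab; decide) (by decide) hA h ![x, y]
      (q := x * y) ?_ hne)
    have h1 : ab = {0} + {1} := rfl
    rw [h1, h.mon_add, h.mon_singleton, h.mon_singleton]
    rfl
  by_cases ha : W (Sc single)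
  · refine isFinitelyBased_of_list (nilTwoIdentity :: nilTopIdentities) fun A _ => ?_
    rw [List.forall_mem_cons]
    constructor
    · intro hA
      obtain ⟨o, h⟩ := htop hA
      exact ⟨h.satisfies_nilTwoIdentity.2 (h2 hA h), hids hA⟩
    · rintro ⟨h1, h4⟩
      obtain ⟨o, h⟩ := satisfies_nilTopIdentities.1 h4
      exact h.mem_of_single hW ha (h.satisfies_nilTwoIdentity.1 h1)
  have h1 {A : Type} [AiSemiring A] (hA : W A) {o : A} (h : IsNilTop A o) (x : A) : x = o := by
    by_contra hne
    refine ha (Sc.mem_of_mon_ne_top hW (by unfold single; decide) (by decide) hA h (fun _ => x)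
      (q := x) ?_ hne)
    exact h.mon_singleton _ _
  refine isFinitelyBased_of_list [(Term.var 0, Term.var 1)] fun A _ => ?_
  rw [List.forall_mem_singleton]
  constructor
  · intro hA v
    obtain ⟨o, h⟩ := htop hA
    rw [h1 hA h (Term.eval v _), h1 hA h (Term.eval v (Term.var 1))]
  · intro h
    have : Subsingleton A := ⟨fun x y => h (assign x y x y)⟩
    exact hW.mem_of_subsingleton

theorem IsProperSubvariety.isFinitelyBased {W : AlgClass}
    (hW : IsProperSubvariety W (generatedVariety (Sc abc))) : IsFinitelyBased W := by
  obtain ⟨hV, hsub, A, _, hA, hnA⟩ := hW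
  exact isFinitelyBased_of_subvariety hV hsub fun hS => hnA (hA W hV hS)

/-! ### Flat semirings of linear 3-hypergraphs -/

open Classical in
/-- The flat semiring on a commutative 0-cancellative semigroup with zero. -/
@[reducible] noncomputable def ofCancel (A : Type*) [Mul A] (z : A)
    (hassoc : ∀ a b c : A, a * b * c = a * (b * c)) (hcomm : ∀ a b : A, a * b = b * a)
    (hz : ∀ a : A, a * z = z) (hcancel : ∀ a b c : A, a * b = a * c → a * b ≠ z → b = c) :
    AiSemiring A :=
  have hdist (a b c : A) : a * (if b = c then b else z) = if a * b = a * c then a * b else z := by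
    by_cases h : b = c
    · simp [h]
    · by_cases h' : a * b = a * c
      · by_cases h0 : a * b = z
        · simp [h, ← h', h0, hz]
        · exact absurd (hcancel a b c h' h0) h
      · simp [h, h', hz]
  { add := fun a b => if a = b then a else z
    add_assoc := fun a b c => by
      change (if (if a = b then a else z) = c then (if a = b then a else z) else z) =
        if a = (if b = c then b else z) then a else z
      by_cases h1 : a = b
      · subst h1
        by_cases h2 : a = c
        · simp [h2]
        · simp only [h2, if_true, if_false]
          split_ifs with h3
          · exact h3.symm
          · rfl
      · by_cases h2 : b = c
        · subst h2; simp [h1]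
        · by_cases h3 : z = c <;> by_cases h4 : a = z <;> simp [h1, h2, h3, h4] 
          exact fun h => h.symm
    add_comm := fun a b => by
      change (if a = b then a else z) = if b = a then b else z
      by_cases h : a = b
      · simp [h]
      · rw [if_neg h, if_neg (Ne.symm h)]
    mul_assoc := hassoc
    left_distrib := hdist
    right_distrib := fun a b c => by
      rw [hcomm, hcomm a c, hcomm b c]
      exact hdist c a b
    add_idem := fun a => if_pos rfl
    nonempty := ⟨z⟩ }

/-- A 3-uniform hypergraph in which two vertices lie in at most one edge, given by the function that
takes two vertices of an edge to the third one. -/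
structure LinearHypergraph (V : Type*) where
  third : V → V → Option V
  comm : ∀ x y, third x y = third y x
  rot : ∀ x y z, third x y = some z → third y z = some x

namespace LinearHypergraph
variable {V : Type*}

/-- The elements of the flat semiring of a hypergraph: the vertices, their complements (the products
of the two other vertices of an edge), the product `top` of any edge, and `0`. -/
inductive Alg (H : LinearHypergraph V)
  | zero
  | pt (x : V)
  | copt (x : V)
  | top

namespace Alg
variable {H : LinearHypergraph V}

open Classical in
noncomputable instance : Mul (Alg H) where
  mul
    | pt x, pt y => (H.third x y).elim zero copt
    | pt x, copt y => if x = y then top else zero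
    | copt x, pt y => if x = y then top else zero
    | _, _ => zero

theorem pt_mul_pt (x y : V) : (pt x * pt y : Alg H) = (H.third x y).elim zero copt := rfl

theorem pt_mul_pt_of_some {x y z : V} (h : H.third x y = some z) : (pt x * pt y : Alg H) = copt z := by
  rw [pt_mul_pt, h]; rfl

theorem pt_mul_pt_of_none {x y : V} (h : H.third x y = none) : (pt x * pt y : Alg H) = zero := by
  rw [pt_mul_pt, h]; rfl

open Classical in
theorem pt_mul_copt (x y : V) : (pt x * copt y : Alg H) = if x = y then top else zero := rfl

open Classical in
theorem copt_mul_pt (x y : V) : (copt x * pt y : Alg H) = if x = y then top else zero := rfl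

theorem copt_mul_copt (x y : V) : (copt x * copt y : Alg H) = zero := rfl

theorem zero_mul' (a : Alg H) : zero * a = zero := by cases a <;> rfl

theorem mul_zero' (a : Alg H) : a * zero = zero := by cases a <;> rfl

theorem top_mul (a : Alg H) : top * a = zero := by cases a <;> rfl

theorem mul_top (a : Alg H) : a * top = zero := by cases a <;> rfl

open Classical in
theorem mul_comm' (a b : Alg H) : a * b = b * a := by
  rcases a with _ | x | x | _ <;> rcases b with _ | y | y | _ <;> try rfl
  · rw [pt_mul_pt, pt_mul_pt, H.comm]
  · rw [pt_mul_copt, copt_mul_pt, if_congr eq_comm rfl rfl]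
  · rw [pt_mul_copt, copt_mul_pt, if_congr eq_comm rfl rfl]

open Classical in
theorem pt_mul_pt_mul_pt (x y z : V) :
    (pt x * pt y * pt z : Alg H) = if H.third x y = some z then top else zero := by
  rcases h : H.third x y with _ | u
  · rw [pt_mul_pt_of_none h, zero_mul']; simp
  · rw [pt_mul_pt_of_some h, copt_mul_pt]; simp

theorem mul_eq_zero_of_copt (x : V) (a b : Alg H) : copt x * a * b = zero := by
  rcases a with _ | y | y | _
  · exact zero_mul' b
  · rw [copt_mul_pt]; split_ifs
    · exact top_mul b
    · exact zero_mul' b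
  · exact zero_mul' b
  · exact zero_mul' b

theorem mul_mul_eq_zero_of_copt (x : V) (a b : Alg H) : a * (b * copt x) = zero := by
  rw [mul_comm', mul_comm' b, mul_eq_zero_of_copt]

-- The only triple products that can be nonzero are those of three vertices, which are symmetric by
-- `rot`.
open Classical in
theorem mul_assoc' (a b c : Alg H) : a * b * c = a * (b * c) := by
  rcases a with _ | x | x | _
  · simp only [zero_mul']
  · rcases b with _ | y | y | _
    · simp only [zero_mul', mul_zero']
    · rcases c with _ | z | z | _
      · simp only [mul_zero']
      · rw [mul_comm' (pt x) (pt y * pt z), pt_mul_pt_mul_pt, pt_mul_pt_mul_pt]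
        have h : H.third x y = some z ↔ H.third y z = some x :=
          ⟨H.rot x y z, fun h => H.rot z x y (H.rot y z x h)⟩
        exact if_congr h rfl rfl
      · rw [mul_mul_eq_zero_of_copt, pt_mul_pt]
        rcases H.third x y with _ | u <;> rfl
      · simp only [mul_top, mul_zero']
    · rw [mul_comm' (pt x), mul_comm' (copt y) c, mul_mul_eq_zero_of_copt, mul_eq_zero_of_copt]
    · simp only [mul_top, top_mul, zero_mul', mul_zero']
  · rw [mul_eq_zero_of_copt, mul_comm' (copt x)]
    rcases b with _ | y | y | _
    · simp only [zero_mul']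
    · rcases c with _ | z | z | _
      · simp only [mul_zero', zero_mul']
      · rw [pt_mul_pt]
        rcases H.third y z with _ | u <;> rfl
      · rw [mul_comm' (pt y), mul_eq_zero_of_copt]
      · simp only [mul_top, zero_mul']
    · rw [mul_eq_zero_of_copt]
    · simp only [top_mul, zero_mul']
  · simp only [top_mul, zero_mul']

/-- Linearity enters here: applying `rot` twice recovers `y` from `x` and the third vertex of their
edge. -/
theorem mul_left_cancel' (a b c : Alg H) (h : a * b = a * c) (h0 : a * b ≠ zero) : b = c := by
  rcases a with _ | x | x | _
  · exact absurd (zero_mul' b) h0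
  · have key (b c : Alg H) (h : pt x * b = pt x * c) (h0 : pt x * b ≠ zero) :
        (∃ y, b = pt y) → b = c := by
      rintro ⟨y, rfl⟩
      rcases hy : H.third x y with _ | u
      · exact absurd (pt_mul_pt_of_none hy) h0
      rw [pt_mul_pt_of_some hy] at h
      rcases c with _ | z | z | _
      · cases h
      · rcases hz : H.third x z with _ | v
        · rw [pt_mul_pt_of_none hz] at h; cases h
        · rw [pt_mul_pt_of_some hz] at h
          cases h
          have h1 := H.rot _ _ _ (H.rot _ _ _ hy)
          have h2 := H.rot _ _ _ (H.rot _ _ _ hz)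
          rw [h1] at h2
          cases h2; rfl
      · rw [pt_mul_copt] at h; split_ifs at h
      · cases h
    rcases b with _ | y | y | _
    · exact absurd (mul_zero' _) h0
    · exact key _ _ h h0 ⟨y, rfl⟩
    · rcases c with _ | z | z | _
      · exact absurd h h0
      · exact (key _ _ h.symm (h ▸ h0) ⟨z, rfl⟩).symm
      · rw [pt_mul_copt] at h h0
        rw [pt_mul_copt] at h
        split_ifs at h h0 with h1 h2
        · rw [← h1, h2]
        · exact absurd rfl h0
      · exact absurd h h0
    · exact absurd (mul_top _) h0
  · have key (b : Alg H) (h0 : copt x * b ≠ zero) : b = pt x := by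
      rcases b with _ | y | y | _
      · exact absurd rfl h0
      · rw [copt_mul_pt] at h0
        split_ifs at h0 with h1
        · rw [h1]
        · exact absurd rfl h0
      · exact absurd rfl h0
      · exact absurd rfl h0
    rw [key b h0, key c (h ▸ h0)]
  · exact absurd (top_mul b) h0

theorem mul_ne_pt (a b : Alg H) (x : V) : a * b ≠ pt x := by
  intro h
  rcases a with _ | y | y | _ <;> rcases b with _ | z | z | _ <;> try cases h
  · rcases hyz : H.third y z with _ | u
    · rw [pt_mul_pt_of_none hyz] at h; cases h
    · rw [pt_mul_pt_of_some hyz] at h; cases h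
  · rw [pt_mul_copt] at h; split_ifs at h
  · rw [copt_mul_pt] at h; split_ifs at h

noncomputable instance : AiSemiring (Alg H) :=
  ofCancel (Alg H) zero mul_assoc' mul_comm' mul_zero' mul_left_cancel'

theorem add_of_ne {a b : Alg H} (h : a ≠ b) : a + b = zero := if_neg h

theorem eq_of_add_ne_zero {a b : Alg H} (h : a + b ≠ zero) : a = b := by
  by_contra h'; exact h (add_of_ne h')

/-- The map to `S_c(abc)` defined by a colouring of the vertices. -/
def color (c : V → Fin 3) : Alg H → Sc abc
  | zero => 0
  | pt x => Sc.ofWord abc {c x}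
  | copt x => Sc.ofWord abc (abc - {c x})
  | top => Sc.ofWord abc abc

end Alg
end LinearHypergraph

/-! ### Multiplication table of S_c(abc) -/

theorem ofWord_letter_mul_letter {i j k : Fin 3} (hij : i ≠ j) (hik : i ≠ k) (hjk : j ≠ k) :
    Sc.ofWord abc {i} * Sc.ofWord abc {j} = Sc.ofWord abc (abc - {k}) := by
  revert i j k; decide

theorem ofWord_letter_mul_self (i : Fin 3) : Sc.ofWord abc {i} * Sc.ofWord abc {i} = 0 := by
  revert i; decide

theorem ofWord_letter_mul_coletter (i j : Fin 3) :
    Sc.ofWord abc {i} * Sc.ofWord abc (abc - {j}) = if i = j then Sc.ofWord abc abc else 0 := by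
  revert i j; decide

theorem ofWord_coletter_mul_coletter (i j : Fin 3) :
    Sc.ofWord abc (abc - {i}) * Sc.ofWord abc (abc - {j}) = 0 := by
  revert i j; decide

theorem ofWord_top_mul (x : Sc abc) : Sc.ofWord abc abc * x = 0 := by
  by_contra h
  obtain ⟨-, hx, hle⟩ := Sc.mul_ne_zero_iff.1 h
  rw [Sc.val_ofWord le_rfl, add_le_iff_nonpos_right] at hle
  exact hx (Sc.val_eq_zero.1 (Multiset.le_zero.1 hle))

theorem ofWord_letter_injective {i j : Fin 3} (h : Sc.ofWord abc {i} = Sc.ofWord abc {j}) : i = j := by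
  revert i j; decide

theorem ofWord_coletter_injective {i j : Fin 3}
    (h : Sc.ofWord abc (abc - {i}) = Sc.ofWord abc (abc - {j})) : i = j := by
  revert i j; decide

theorem ofWord_ne : (∀ i, Sc.ofWord abc {i} ≠ 0) ∧ (∀ i, Sc.ofWord abc (abc - {i}) ≠ 0) ∧
    Sc.ofWord abc abc ≠ 0 ∧ (∀ i j, Sc.ofWord abc {i} ≠ Sc.ofWord abc (abc - {j})) ∧
    (∀ i, Sc.ofWord abc {i} ≠ Sc.ofWord abc abc) ∧
    (∀ i, Sc.ofWord abc (abc - {i}) ≠ Sc.ofWord abc abc) := by decide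

/-! ### Transfer of identities by colourings -/

namespace LinearHypergraph
variable {V : Type} {H : LinearHypergraph V}

theorem Alg.color_ne_zero (c : V → Fin 3) {a : Alg H} (ha : a ≠ .zero) : a.color c ≠ 0 := by
  rcases a with _ | x | x | _
  · exact absurd rfl ha
  · exact ofWord_ne.1 _
  · exact ofWord_ne.2.1 _
  · exact ofWord_ne.2.2.1

theorem Alg.eq_of_color_eq {C : Set (V → Fin 3)} (hC : C.Nonempty)
    (hsep : ∀ x y, x ≠ y → ∃ c ∈ C, c x ≠ c y) {a b : Alg H}
    (h : ∀ c ∈ C, a.color c = b.color c) : a = b := by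
  obtain ⟨c₀, hc₀⟩ := hC
  have h₀ := h c₀ hc₀
  obtain ⟨n1, n2, n3, n4, n5, n6⟩ := ofWord_ne
  have hv {x y : V} (hxy : ∀ c ∈ C, c x = c y) : x = y := by
    by_contra hne
    obtain ⟨c, hc, hne'⟩ := hsep x y hne
    exact hne' (hxy c hc)
  rcases a with _ | x | x | _ <;> rcases b with _ | y | y | _
  · rfl
  · exact absurd h₀.symm (n1 _)
  · exact absurd h₀.symm (n2 _)
  · exact absurd h₀.symm n3
  · exact absurd h₀ (n1 _)
  · rw [hv fun c hc => ofWord_letter_injective (h c hc)]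
  · exact absurd h₀ (n4 _ _)
  · exact absurd h₀ (n5 _)
  · exact absurd h₀ (n2 _)
  · exact absurd h₀.symm (n4 _ _)
  · rw [hv fun c hc => ofWord_coletter_injective (h c hc)]
  · exact absurd h₀ (n6 _)
  · exact absurd h₀ n3
  · exact absurd h₀.symm (n5 _)
  · exact absurd h₀.symm (n6 _)
  · rfl

/-- A zero product of two vertices is detected by a colouring that identifies them; a zero product
of a vertex and a complement, by one that separates the two vertices involved. -/
theorem Alg.mul_ne_zero_of_color {C : Set (V → Fin 3)} (hC : C.Nonempty)
    (hsep : ∀ x y, x ≠ y → ∃ c ∈ C, c x ≠ c y)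
    (hadj : ∀ x y, H.third x y = none → ∃ c ∈ C, c x = c y) {a b : Alg H}
    (h : ∀ c ∈ C, a.color c * b.color c ≠ 0) : a * b ≠ .zero := by
  obtain ⟨c₀, hc₀⟩ := hC
  have h₀ := h c₀ hc₀
  have key (x y : V) (hxy : ∀ c ∈ C, Sc.ofWord abc {c x} * Sc.ofWord abc (abc - {c y}) ≠ 0) :
      x = y := by
    by_contra hne
    obtain ⟨c, hc, hne'⟩ := hsep x y hne
    exact hxy c hc (by rw [ofWord_letter_mul_coletter, if_neg hne'])
  rcases a with _ | x | x | _
  · exact absurd (Sc.zero_mul _) h₀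
  · rcases b with _ | y | y | _
    · exact absurd (Sc.mul_zero _) h₀
    · rcases hxy : H.third x y with _ | z
      · obtain ⟨c, hc, heq⟩ := hadj x y hxy
        refine absurd ?_ (h c hc)
        simp only [color, heq]
        exact ofWord_letter_mul_self _
      · rw [pt_mul_pt_of_some hxy]; nofun
    · rw [pt_mul_copt, if_pos (key x y h)]; nofun
    · exact absurd ((Sc.mul_comm' _ _).trans (ofWord_top_mul _)) h₀
  · rcases b with _ | y | y | _
    · exact absurd (Sc.mul_zero _) h₀
    · rw [copt_mul_pt, if_pos (key y x fun c hc => by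
        rw [Sc.mul_comm']; exact h c hc).symm]
      nofun
    · exact absurd (ofWord_coletter_mul_coletter _ _) h₀
    · exact absurd ((Sc.mul_comm' _ _).trans (ofWord_top_mul _)) h₀
  · exact absurd (ofWord_top_mul _) h₀

/-- The semiring of a hypergraph satisfies an identity of `S_c(abc)` under each assignment to
elements other than the vertices outside `D`, if there are sufficiently many maps to three colours
that are injective on the edges with two vertices in `D`. -/
theorem eval_eq_of_colorings (D : Set V) {C : Set (V → Fin 3)} (hC : C.Nonempty)
    (hvalid : ∀ c ∈ C, ∀ x ∈ D, ∀ y ∈ D, ∀ z, H.third x y = some z →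
      c x ≠ c y ∧ c x ≠ c z ∧ c y ≠ c z)
    (hsep : ∀ x y, x ≠ y → ∃ c ∈ C, c x ≠ c y)
    (hadj : ∀ x y, H.third x y = none → ∃ c ∈ C, c x = c y)
    {X : Type} {s t : Term X} (hst : ∀ v : X → Sc abc, s.eval v = t.eval v)
    (v : X → Alg H) (hv : ∀ x y, v x = .pt y → y ∈ D) : s.eval v = t.eval v := by
  -- Products are never vertices and nonzero sums have equal summands, so terms produce no vertex
  -- outside `D`. Hence `hvalid` suffices for `heval`.
  have hD (r : Term X) : ∀ y, r.eval v = .pt y → y ∈ D := by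
    induction r with
    | var x => exact hv x
    | add r₁ r₂ ih₁ ih₂ =>
      intro y hy
      simp only [Term.eval] at hy
      have h1 := Alg.eq_of_add_ne_zero (a := r₁.eval v) (b := r₂.eval v)
        (by rw [hy]; nofun)
      rw [h1, add_idem] at hy
      exact ih₂ y hy
    | mul r₁ r₂ _ _ =>
      intro y hy
      exact absurd hy (Alg.mul_ne_pt _ _ _)
  have heval (r : Term X) (c : V → Fin 3) (hc : c ∈ C) (hr : r.eval v ≠ .zero) :
      r.eval (fun x => (v x).color c) = (r.eval v).color c := by
    induction r with
    | var x => rfl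
    | add r₁ r₂ ih₁ ih₂ =>
      simp only [Term.eval] at hr ⊢
      have h1 := Alg.eq_of_add_ne_zero hr
      rw [← h1, add_idem] at hr ⊢
      rw [ih₁ hr, ih₂ (h1 ▸ hr), ← h1, add_idem]
    | mul r₁ r₂ ih₁ ih₂ =>
      have hD₁ := hD r₁
      have hD₂ := hD r₂
      simp only [Term.eval] at hr ⊢
      have h1 : r₁.eval v ≠ .zero := fun h => hr (by rw [h, Alg.zero_mul'])
      have h2 : r₂.eval v ≠ .zero := fun h => hr (by rw [h, Alg.mul_zero'])
      rw [ih₁ h1, ih₂ h2]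
      generalize r₁.eval v = a at *
      generalize r₂.eval v = b at *
      have key (x y : V) (hxy : Alg.pt x * Alg.copt y ≠ (.zero : Alg H)) :
          Sc.ofWord abc {c x} * Sc.ofWord abc (abc - {c y}) =
            (Alg.pt x * Alg.copt y : Alg H).color c := by
        rw [Alg.pt_mul_copt] at hxy ⊢
        split_ifs at hxy ⊢ with h
        · rw [h, ofWord_letter_mul_coletter, if_pos rfl]; rfl
        · exact absurd rfl hxy
      rcases a with _ | x | x | _
      · exact absurd rfl h1
      · rcases b with _ | y | y | _
        · exact absurd rfl h2
        · rcases hxy : H.third x y with _ | z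
          · exact absurd (Alg.pt_mul_pt_of_none hxy) hr
          · rw [Alg.pt_mul_pt_of_some hxy]
            obtain ⟨e1, e2, e3⟩ := hvalid c hc x (hD₁ x rfl) y (hD₂ y rfl) z hxy
            exact ofWord_letter_mul_letter e1 e2 e3
        · exact key x y hr
        · exact absurd (Alg.mul_top _) hr
      · rcases b with _ | y | y | _
        · exact absurd rfl h2
        · rw [Alg.mul_comm'] at hr ⊢
          rw [Sc.mul_comm']
          exact key y x hr
        · exact absurd (Alg.copt_mul_copt _ _) hr
        · exact absurd (Alg.mul_top _) hr
      · exact absurd (Alg.top_mul _) hr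
  have hconv (r : Term X) (hr : ∀ c ∈ C, r.eval (fun x => (v x).color c) ≠ 0) :
      r.eval v ≠ .zero := by
    induction r with
    | var x =>
      obtain ⟨c, hc⟩ := hC
      intro h
      simp only [Term.eval] at h
      exact hr c hc (by simp only [Term.eval, h]; rfl)
    | add r₁ r₂ ih₁ ih₂ =>
      simp only [Term.eval] at hr ⊢
      replace ih₁ := ih₁ fun c hc h0 => hr c hc (by rw [h0, Sc.zero_add])
      replace ih₂ := ih₂ fun c hc h0 => hr c hc (by rw [h0, Sc.add_zero])
      have h1 : r₁.eval v = r₂.eval v := by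
        refine Alg.eq_of_color_eq hC hsep fun c hc => ?_
        rw [← heval r₁ c hc ih₁, ← heval r₂ c hc ih₂]
        exact Sc.eq_of_add_ne_zero (hr c hc)
      rw [h1, add_idem]
      exact ih₂
    | mul r₁ r₂ ih₁ ih₂ =>
      simp only [Term.eval] at hr ⊢
      replace ih₁ := ih₁ fun c hc h0 => hr c hc (by rw [h0, Sc.zero_mul])
      replace ih₂ := ih₂ fun c hc h0 => hr c hc (by rw [h0, Sc.mul_zero])
      refine Alg.mul_ne_zero_of_color hC hsep hadj fun c hc => ?_
      rw [← heval r₁ c hc ih₁, ← heval r₂ c hc ih₂]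
      exact hr c hc
  have key (s t : Term X) (hst : ∀ v : X → Sc abc, s.eval v = t.eval v) (hs : s.eval v ≠ .zero) :
      s.eval v = t.eval v := by
    have hsc (c) (hc : c ∈ C) : t.eval (fun x => (v x).color c) = (s.eval v).color c := by
      rw [← hst, heval s c hc hs]
    have ht : t.eval v ≠ .zero := hconv t fun c hc => by
      rw [hsc c hc]; exact Alg.color_ne_zero c hs
    refine Alg.eq_of_color_eq hC hsep fun c hc => ?_
    rw [← hsc c hc, heval t c hc ht]
  by_cases hs : s.eval v = .zero
  · by_cases ht : t.eval v = .zero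
    · rw [hs, ht]
    · exact (key t s (fun v => (hst v).symm) ht).symm
  · exact key s t hst hs

end LinearHypergraph
/-! ### Prisms -/

/-- The edges of the prism over the cycle of length `m`: the rungs and the edges of the two cycles. -/
inductive PrismEdge (m : ℕ)
  | rail (b : Bool) (i : ZMod m)
  | rung (i : ZMod m)

namespace PrismEdge
variable {m : ℕ}

/-- The third edge of the prism at a common endpoint of two edges. -/
def third : PrismEdge m → PrismEdge m → Option (PrismEdge m)
  | rail b i, rail b' j =>
    if b = b' then if j = i + 1 then some (rung i) else if i = j + 1 then some (rung j) else none
    else none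
  | rail b i, rung k => if i = k then some (rail b (k + 1)) else
      if i = k + 1 then some (rail b k) else none
  | rung k, rail b i => if i = k then some (rail b (k + 1)) else
      if i = k + 1 then some (rail b k) else none
  | rung _, rung _ => none

theorem one_ne_zero' (hm : 3 ≤ m) : (1 : ZMod m) ≠ 0 := by
  have : Fact (1 < m) := ⟨by omega⟩
  exact one_ne_zero

theorem two_ne_zero' (hm : 3 ≤ m) : (1 + 1 : ZMod m) ≠ 0 := by
  intro h
  have h2 : ((2 : ℕ) : ZMod m) = 0 := by push_cast; rw [← h]; norm_num
  rw [ZMod.natCast_eq_zero_iff] at h2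
  exact absurd (Nat.le_of_dvd (by norm_num) h2) (by omega)

/-- The hypergraph whose vertices are the edges of a prism and whose edges are the vertices of the
prism. -/
def hypergraph (hm : 3 ≤ m) : LinearHypergraph (PrismEdge m) where
  third := third
  comm x y := by
    rcases x with ⟨b, i⟩ | i <;> rcases y with ⟨b', j⟩ | j <;> try rfl
    simp only [third, eq_comm (a := b)]
    split_ifs with h1 h2 h3 <;> try rfl
    rw [h2, add_assoc, left_eq_add] at h3
    exact absurd h3 (two_ne_zero' hm)
  rot x y z h := by
    have h1 := one_ne_zero' hm
    rcases x with ⟨b, i⟩ | i <;> rcases y with ⟨b', j⟩ | j <;> simp only [third] at h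
    · split_ifs at h with e1 e2 e3
      · cases h
        subst e1 e2
        simp [third, h1]
      · cases h
        subst e1 e3
        simp [third]
    · split_ifs at h with e1 e2
      · cases h
        subst e1
        simp [third]
      · cases h
        subst e2
        simp [third]
    · split_ifs at h with e1 e2
      · cases h
        subst e1
        simp [third]
      · cases h
        subst e2
        have h2 : i ≠ i + 1 + 1 := by
          rw [add_assoc, ne_eq, left_eq_add]; exact two_ne_zero' hm
        simp [third, h2]
    · cases h

/-! Colourings of the prism that is cut open at the index `j`. -/

/-- The position of an index in the cycle cut open after `j`. -/
def pos (j i : ZMod m) : ℕ := (i - (j + 1)).val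

theorem natCast_pos [NeZero m] (j i : ZMod m) : (pos j i : ZMod m) = i - (j + 1) :=
  ZMod.natCast_zmod_val _

theorem pos_injective [NeZero m] (j : ZMod m) : Function.Injective (pos j) := fun a b h => by
  have := congrArg (Nat.cast : ℕ → ZMod m) h
  rwa [natCast_pos, natCast_pos, sub_left_inj] at this

theorem eq_add_one_of_pos [NeZero m] {j i k : ZMod m} (h : pos j k = pos j i + 1) : k = i + 1 := by
  have := congrArg (Nat.cast : ℕ → ZMod m) h
  rw [Nat.cast_add, natCast_pos, natCast_pos, Nat.cast_one] at this
  linear_combination this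

/-- The index `j` has the last position m - 1, and only there does the successor wrap around. -/
theorem pos_add_one [NeZero m] {j i : ZMod m} (h : i ≠ j) : pos j (i + 1) = pos j i + 1 := by
  have h1 : pos j i < m := ZMod.val_lt _
  have h2 : pos j i + 1 ≠ m := by
    intro h2
    have := congrArg (Nat.cast : ℕ → ZMod m) h2
    rw [Nat.cast_add, natCast_pos, Nat.cast_one, ZMod.natCast_self] at this
    exact h (by linear_combination this)
  have h3 : i + 1 - (j + 1) = ((pos j i + 1 : ℕ) : ZMod m) := by
    rw [Nat.cast_add, natCast_pos, Nat.cast_one]; ring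
  rw [pos, h3, ZMod.val_natCast_of_lt (by omega)]

/-- The colour, `0` or `1`, given by the parity of a natural number. -/
def par (p : ℕ) : Fin 3 := if p % 2 = 0 then 0 else 1

theorem par_eq_iff {p q : ℕ} : par p = par q ↔ p % 2 = q % 2 := by
  unfold par
  split_ifs <;> simp <;> omega

theorem par_ne_two (p : ℕ) : par p ≠ 2 := by
  unfold par
  split_ifs <;> decide

/-- The three colours add up to 0 modulo 3, so the third colour besides distinct a and b is -(a +
b). -/
theorem neg_par_add_par (p : ℕ) : -(par p + par (p + 1)) = 2 := by
  unfold par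
  split_ifs <;> first | omega | decide

theorem ne_neg_add {a b : Fin 3} (h : a ≠ b) : a ≠ -(a + b) ∧ b ≠ -(a + b) := by
  revert a b; decide

/-- The colouring in which the two cycles alternate between two colours, in opposite ways. -/
def altColor (j : ZMod m) : PrismEdge m → Fin 3
  | rail b i => par (pos j i + b.toNat)
  | rung _ => 2

/-- The colouring in which the two cycles are coloured alike. -/
def walkColor (s : ℕ → Fin 3) (j : ZMod m) : PrismEdge m → Fin 3
  | rail _ i => s (pos j i)
  | rung i => -(s (pos j i) + s (pos j i + 1))

/-- The index of an edge of the prism. -/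
def index : PrismEdge m → ZMod m
  | rail _ i => i
  | rung i => i

/-- The colourings of the prism cut open after the index `j`. -/
def colorings (j : ZMod m) : Set (PrismEdge m → Fin 3) :=
  insert (altColor j) {c | ∃ s : ℕ → Fin 3, (∀ p, s p ≠ s (p + 1)) ∧ c = walkColor s j}

theorem altColor_mem (j : ZMod m) : altColor j ∈ colorings j := Set.mem_insert _ _

theorem walkColor_mem {s : ℕ → Fin 3} (hs : ∀ p, s p ≠ s (p + 1)) (j : ZMod m) :
    walkColor s j ∈ colorings j := Set.mem_insert_of_mem _ ⟨s, hs, rfl⟩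

theorem colorings_injective_at [NeZero m] {j i : ZMod m} (hi : i ≠ j)
    {c : PrismEdge m → Fin 3} (hc : c ∈ colorings j) (b : Bool) :
    c (rail b i) ≠ c (rail b (i + 1)) ∧ c (rail b i) ≠ c (rung i) ∧
      c (rail b (i + 1)) ≠ c (rung i) := by
  rcases hc with rfl | ⟨s, hs, rfl⟩
  · simp only [altColor, pos_add_one hi]
    refine ⟨?_, par_ne_two _, par_ne_two _⟩
    rw [ne_eq, par_eq_iff]
    omega
  · simp only [walkColor, pos_add_one hi]
    exact ⟨hs _, (ne_neg_add (hs _)).1, (ne_neg_add (hs _)).2⟩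

/-- A prism vertex at the cut `j` has only one incident edge of index other than `j`, namely `rail b
(j + 1)`. So `x` and `y` meet away from the cut, where the colouring is proper. -/
theorem colorings_valid [NeZero m] {j : ZMod m} {c : PrismEdge m → Fin 3} (hc : c ∈ colorings j)
    {x y z : PrismEdge m} (hx : x.index ≠ j) (hy : y.index ≠ j) (h : third x y = some z) :
    c x ≠ c y ∧ c x ≠ c z ∧ c y ≠ c z := by
  rcases x with ⟨b, i⟩ | i <;> rcases y with ⟨b', k⟩ | k <;> simp only [third] at h <;>
    simp only [index] at hx hy
  · split_ifs at h with e1 e2 e3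
    · cases h
      subst e1 e2
      exact colorings_injective_at hx hc b
    · cases h
      subst e1 e3
      have := colorings_injective_at hy hc b
      tauto
  · split_ifs at h with e1 e2
    · cases h
      subst e1
      have := colorings_injective_at hx hc b
      tauto
    · cases h
      subst e2
      have := colorings_injective_at hy hc b
      tauto
  · split_ifs at h with e1 e2
    · cases h
      subst e1
      have := colorings_injective_at hx hc b'
      tauto
    · cases h
      subst e2
      have := colorings_injective_at hx hc b'
      tauto
  · cases h

/-- A walk between three colours that visits the third colour once only. -/
def marker (k p : ℕ) : Fin 3 := if p = k then 2 else par p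

theorem marker_ne (k p : ℕ) : marker k p ≠ marker k (p + 1) := by
  unfold marker
  split_ifs with h1 h2
  · omega
  · exact (par_ne_two _).symm
  · exact par_ne_two _
  · rw [ne_eq, par_eq_iff]; omega

theorem par_ne (p : ℕ) : par p ≠ par (p + 1) := by rw [ne_eq, par_eq_iff]; omega

/-- A walk between three colours that changes its phase after `k`. -/
def shift (k p : ℕ) : Fin 3 := if p ≤ k then par p else if p = k + 1 then 2 else par (p + 1)

theorem shift_ne (k p : ℕ) : shift k p ≠ shift k (p + 1) := by
  unfold shift
  split_ifs <;> first
    | omega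
    | exact par_ne_two _
    | exact (par_ne_two _).symm
    | (rw [ne_eq, par_eq_iff]; omega)

theorem colorings_separate [NeZero m] (j : ZMod m) {x y : PrismEdge m} (hxy : x ≠ y) :
    ∃ c ∈ colorings j, c x ≠ c y := by
  -- The marker lies on a rail at the earlier rung only, so the later rung has colour 2 and the
  -- earlier one does not.
  have hrung {i k : ZMod m} (h : pos j i < pos j k) :
      ∃ c ∈ colorings j, c (rung i) ≠ c (rung k) := by
    refine ⟨_, walkColor_mem (marker_ne (pos j i)) j, ?_⟩
    have h1 : -(marker (pos j i) (pos j k) + marker (pos j i) (pos j k + 1)) = 2 := by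
      rw [marker, marker, if_neg (by omega), if_neg (by omega), neg_par_add_par]
    simp only [walkColor, h1]
    rw [marker, marker, if_pos rfl, if_neg (by omega)]
    have h2 := (ne_neg_add (par_ne_two (pos j i + 1)).symm).1
    exact h2.symm
  rcases x with ⟨b, i⟩ | i <;> rcases y with ⟨b', k⟩ | k
  · by_cases hik : i = k
    · subst hik
      refine ⟨_, altColor_mem j, ?_⟩
      have hb : b ≠ b' := fun h => hxy (by rw [h])
      simp only [altColor, ne_eq, par_eq_iff]
      cases b <;> cases b' <;> simp at hb ⊢ <;> omega
    · refine ⟨_, walkColor_mem (marker_ne (pos j i)) j, ?_⟩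
      have h1 : pos j k ≠ pos j i := fun h => hik (pos_injective j h).symm
      simp only [walkColor, marker, if_neg h1, if_true]
      exact (par_ne_two _).symm
  · exact ⟨_, altColor_mem j, par_ne_two _⟩
  · exact ⟨_, altColor_mem j, (par_ne_two _).symm⟩
  · have hik : pos j i ≠ pos j k := fun h => hxy (by rw [pos_injective j h])
    rcases lt_or_gt_of_ne hik with h | h
    · exact hrung h
    · obtain ⟨c, hc, hne⟩ := hrung h
      exact ⟨c, hc, hne.symm⟩

theorem exists_coloring_eq [NeZero m] (j : ZMod m) {x y : PrismEdge m} (h : third x y = none) :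
    ∃ c ∈ colorings j, c x = c y := by
  have hrail {b : Bool} {i k : ZMod m} (h : k ≠ i + 1) (hlt : pos j i < pos j k) :
      ∃ c ∈ colorings j, c (rail b i) = c (rail b k) := by
    have h1 : pos j k ≠ pos j i + 1 := fun h' => h (eq_add_one_of_pos h')
    by_cases h2 : pos j i % 2 = pos j k % 2
    · exact ⟨_, walkColor_mem par_ne j, par_eq_iff.2 h2⟩
    -- The positions have opposite parity and are not consecutive, so there is room for a change of
    -- phase between them.
    · refine ⟨_, walkColor_mem (shift_ne (pos j i)) j, ?_⟩
      simp only [walkColor, shift]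
      rw [if_pos le_rfl, if_neg (by omega), if_neg h1, par_eq_iff]
      omega
  have hmix {b : Bool} {i k : ZMod m} (h1 : i ≠ k) (h2 : i ≠ k + 1) :
      ∃ c ∈ colorings j, c (rail b i) = c (rung k) := by
    refine ⟨_, walkColor_mem (marker_ne (pos j i)) j, ?_⟩
    have h3 : pos j k ≠ pos j i := fun h => h1 (pos_injective j h).symm
    have h4 : pos j k + 1 ≠ pos j i := fun h => h2 (eq_add_one_of_pos h.symm)
    simp only [walkColor, marker, if_true, if_neg h3, if_neg h4]
    exact (neg_par_add_par _).symm
  rcases x with ⟨b, i⟩ | i <;> rcases y with ⟨b', k⟩ | k <;> simp only [third] at h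
  · split_ifs at h with e1 e2 e3
    · subst e1
      rcases lt_trichotomy (pos j i) (pos j k) with hlt | heq | hlt
      · exact hrail e2 hlt
      · exact ⟨_, altColor_mem j, by rw [pos_injective j heq]⟩
      · obtain ⟨c, hc, he⟩ := hrail (b := b) e3 hlt
        exact ⟨c, hc, he.symm⟩
    · by_cases h2 : pos j i % 2 = pos j k % 2
      · exact ⟨_, walkColor_mem par_ne j, par_eq_iff.2 h2⟩
      · refine ⟨_, altColor_mem j, ?_⟩
        simp only [altColor, par_eq_iff]
        cases b <;> cases b' <;> simp at e1 ⊢ <;> omega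
  · split_ifs at h with e1 e2
    exact hmix e1 e2
  · split_ifs at h with e1 e2
    obtain ⟨c, hc, he⟩ := hmix (b := b') e1 e2
    exact ⟨c, hc, he.symm⟩
  · exact ⟨_, altColor_mem j, rfl⟩

end PrismEdge

/-! ### Identities in few variables hold in the semirings of large prisms -/

/-- A bound for the indices of the variables of a term. -/
def Term.bound : Term ℕ → ℕ
  | .var n => n + 1
  | .add s t => max s.bound t.bound
  | .mul s t => max s.bound t.bound

theorem Term.eval_congr {A : Type*} [AiSemiring A] {v v' : ℕ → A} (t : Term ℕ)
    (h : ∀ n < t.bound, v n = v' n) : t.eval v = t.eval v' := by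
  induction t with
  | var n => exact h n (Nat.lt_succ_self n)
  | add s t hs ht =>
    simp only [Term.eval]
    rw [hs fun n hn => h n (lt_max_of_lt_left hn), ht fun n hn => h n (lt_max_of_lt_right hn)]
  | mul s t hs ht =>
    simp only [Term.eval]
    rw [hs fun n hn => h n (lt_max_of_lt_left hn), ht fun n hn => h n (lt_max_of_lt_right hn)]

/-- Fewer than `m` variables cannot meet all `m` indices, so the prism is cut open at an index `j`
that they miss. -/
theorem satisfies_prism {m : ℕ} (hm : 3 ≤ m) {e : Identity} (he : Satisfies (Sc abc) e)
    (hb : max e.1.bound e.2.bound < m) :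
    Satisfies (PrismEdge.hypergraph hm).Alg e := by
  have : NeZero m := ⟨by omega⟩
  intro v
  set N := max e.1.bound e.2.bound
  -- The value 0 for other elements is arbitrary; at worst it excludes one more index, and the count
  -- still holds.
  let idx : (PrismEdge.hypergraph hm).Alg → ZMod m
    | .pt x => x.index
    | _ => 0
  obtain ⟨j, -, hj⟩ : ∃ j ∈ (Finset.univ : Finset (ZMod m)),
      j ∉ (Finset.range N).image fun n => idx (v n) := by
    apply Finset.exists_mem_notMem_of_card_lt_card
    rw [Finset.card_univ, ZMod.card]
    exact Finset.card_image_le.trans_lt (by rwa [Finset.card_range])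
  let v' : ℕ → (PrismEdge.hypergraph hm).Alg := fun n => if n < N then v n else .zero
  have hv' (t : Term ℕ) (ht : t.bound ≤ N) : t.eval v = t.eval v' :=
    t.eval_congr fun n hn => (if_pos (hn.trans_le ht)).symm
  rw [hv' _ (le_max_left _ _), hv' _ (le_max_right _ _)]
  refine LinearHypergraph.eval_eq_of_colorings {x | PrismEdge.index x ≠ j}
    ⟨_, PrismEdge.altColor_mem j⟩ (fun c hc x hx y hy z h => PrismEdge.colorings_valid hc hx hy h)
    (fun x y => PrismEdge.colorings_separate j) (fun x y h => PrismEdge.exists_coloring_eq j h)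
    he v' fun n y hn hy => hj ?_
  by_cases hnN : n < N
  · simp only [v', if_pos hnN] at hn
    refine Finset.mem_image.2 ⟨n, Finset.mem_range.2 hnN, ?_⟩
    simp only [hn, idx]
    exact hy
  · simp only [v', if_neg hnN] at hn
    cases hn

/-! ### An identity of `S_c(abc)` that fails in the semiring of an odd prism -/

/-- The sum of the first `n + 1` terms of a sequence of terms. -/
def Term.sum {X : Type*} (f : ℕ → Term X) : ℕ → Term X
  | 0 => f 0
  | n + 1 => (Term.sum f n).add (f (n + 1))

theorem Term.sum_eval_add_eq_iff {X A : Type*} [AiSemiring A] (f : ℕ → Term X) (v : X → A) (n : ℕ)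
    (c : A) : (Term.sum f n).eval v + c = c ↔ ∀ k ≤ n, (f k).eval v + c = c := by
  induction n with
  | zero => simp [Term.sum]
  | succ n ih =>
    simp only [Term.sum, Term.eval, add_add_eq_iff, ih]
    constructor
    · rintro ⟨h1, h2⟩ k hk
      rcases Nat.le_succ_iff.1 hk with h | rfl
      · exact h1 k h
      · exact h2
    · exact fun h => ⟨fun k hk => h k (by omega), h _ le_rfl⟩

theorem Term.sum_eval_eq {X A : Type*} [AiSemiring A] (f : ℕ → Term X) (v : X → A) (n : ℕ)
    (c : A) (h : ∀ k, (f k).eval v = c) : (Term.sum f n).eval v = c := by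
  induction n with
  | zero => exact h 0
  | succ n ih => simp only [Term.sum, Term.eval, ih, h, add_idem]

/-- The product of two consecutive edges in the cycles of a prism and the rung at the first one. -/
def cornerTerm {m : ℕ} (b b' : Bool) (i : ZMod m) : Term (PrismEdge m) :=
  ((Term.var (.rail b i)).mul (.var (.rail b' (i + 1)))).mul (.var (.rung i))

/-- The sum of the products of the edges at the vertices of a prism. -/
def prismTerm (m : ℕ) : Term (PrismEdge m) :=
  Term.sum (fun k => (cornerTerm true true (k : ZMod m)).add (cornerTerm false false (k : ZMod m)))
    (m - 1)

theorem Sc.val_of_mul_mul_ne_zero {x y z : Sc abc} (h : x * y * z ≠ 0) :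
    (∃ i, x.val = {i}) ∧ (∃ i, y.val = {i}) ∧ x.val + y.val + z.val = abc := by
  obtain ⟨hxy, hz, hle⟩ := Sc.mul_ne_zero_iff.1 h
  obtain ⟨hx, hy, -⟩ := Sc.mul_ne_zero_iff.1 hxy
  rw [Sc.val_mul hxy] at hle
  have h1 := Multiset.card_pos.2 (mt Sc.val_eq_zero.1 hx)
  have h2 := Multiset.card_pos.2 (mt Sc.val_eq_zero.1 hy)
  have h3 := Multiset.card_pos.2 (mt Sc.val_eq_zero.1 hz)
  have h4 := Multiset.card_le_card hle
  have h5 : Multiset.card abc = 3 := rfl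
  simp only [Multiset.card_add] at h4
  refine ⟨Multiset.card_eq_one.1 (by omega), Multiset.card_eq_one.1 (by omega),
    Multiset.eq_of_le_of_card_le hle ?_⟩
  simp only [Multiset.card_add]
  omega

/-- If the sum is nonzero, all corner products agree and each vertex of the prism sees three
distinct letters. The two rails at an index, if distinct, are interchanged at the next index,
because both cycles share the rung. An odd number of interchanges around the cycle is impossible, so
opposite rails agree and may be exchanged in a corner. -/
theorem eval_prismTerm {m : ℕ} (hodd : m % 2 = 1) (v : PrismEdge m → Sc abc) :
    (prismTerm m).eval v = ((prismTerm m).add (cornerTerm true false 0)).eval v := by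
  simp only [Term.eval]
  set p := (prismTerm m).eval v with hp
  by_cases hp0 : p = 0
  · rw [hp0, Sc.zero_add]
  have hedge (b : Bool) (k : ℕ) (hk : k < m) : (cornerTerm b b (k : ZMod m)).eval v = p := by
    have h1 := (Term.sum_eval_add_eq_iff _ v (m - 1) p).1 (add_idem p) k (by omega)
    simp only [Term.eval] at h1
    have h2 := add_add_eq_iff.1 h1
    have h3 : (cornerTerm b b (k : ZMod m)).eval v + p = p := by
      cases b
      · exact h2.2
      · exact h2.1
    exact Sc.eq_of_add_ne_zero (by rw [h3]; exact hp0)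
  have hval (b : Bool) (k : ℕ) (hk : k < m) := Sc.val_of_mul_mul_ne_zero
    (x := v (.rail b k)) (y := v (.rail b (k + 1))) (z := v (.rung k))
    (by have := hedge b k hk; simp only [cornerTerm, Term.eval] at this; rw [this]; exact hp0)
  have hstep (k : ℕ) (hk : k < m) (hne : v (.rail true k) ≠ v (.rail false k)) :
      v (.rail true (k + 1)) = v (.rail false k) ∧ v (.rail false (k + 1)) = v (.rail true k) := by
    obtain ⟨⟨a, ha⟩, ⟨b, hb⟩, h1⟩ := hval true k hk
    obtain ⟨⟨c, hc⟩, ⟨d, hd⟩, h2⟩ := hval false k hk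
    have hac : a ≠ c := by
      rintro rfl
      exact hne (Sc.val_injective (ha.trans hc.symm))
    have h3 := add_right_cancel (h1.trans h2.symm)
    rw [ha, hb, hc, hd] at h3
    have h4 : b = c ∧ d = a := by
      revert hac h3
      clear * -
      revert a b c d
      decide
    exact ⟨Sc.val_injective (by rw [hb, hc, h4.1]), Sc.val_injective (by rw [hd, ha, h4.2])⟩
  have heq : v (.rail true 0) = v (.rail false 0) := by
    by_contra hne
    have hind (k : ℕ) (hk : k ≤ m) :
        v (.rail true k) = v (.rail (decide (k % 2 = 0)) 0) ∧
        v (.rail false k) = v (.rail (decide (k % 2 = 1)) 0) := by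
      induction k with
      | zero => simp
      | succ k ih =>
        obtain ⟨h1, h2⟩ := ih (by omega)
        have hne' : v (.rail true k) ≠ v (.rail false k) := by
          rw [h1, h2]
          rcases Nat.mod_two_eq_zero_or_one k with h | h
          · simpa [h] using hne
          · simpa [h] using Ne.symm hne
        obtain ⟨h3, h4⟩ := hstep k (by omega) hne'
        push_cast
        rw [h3, h4, h1, h2]
        have e1 : ((k + 1) % 2 = 0) ↔ (k % 2 = 1) := by omega
        have e2 : ((k + 1) % 2 = 1) ↔ (k % 2 = 0) := by omega
        simp only [e1, e2, and_self]
    have := (hind m le_rfl).1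
    rw [ZMod.natCast_self, hodd] at this
    exact hne (by simpa using this)
  have h0 := hedge false 0 (by omega)
  have h1 : (cornerTerm true false (0 : ZMod m)).eval v = p := by
    simp only [cornerTerm, Term.eval, Nat.cast_zero] at h0 ⊢
    rw [heq]
    exact h0
  rw [h1, add_idem]

/-- The added product involves rails of different cycles, which have no common endpoint. -/
theorem eval_prismTerm_ne {m : ℕ} (hm : 3 ≤ m) :
    (prismTerm m).eval (.pt : PrismEdge m → (PrismEdge.hypergraph hm).Alg) ≠
      ((prismTerm m).add (cornerTerm true false 0)).eval .pt := by
  have hcorner (b : Bool) (i : ZMod m) : (cornerTerm b b i).eval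
      (.pt : PrismEdge m → (PrismEdge.hypergraph hm).Alg) = .top := by
    simp only [cornerTerm, Term.eval]
    rw [LinearHypergraph.Alg.pt_mul_pt_mul_pt, if_pos]
    simp [PrismEdge.hypergraph, PrismEdge.third]
  have h1 : (prismTerm m).eval (.pt : PrismEdge m → (PrismEdge.hypergraph hm).Alg) = .top :=
    Term.sum_eval_eq _ _ _ _ fun k => by simp only [Term.eval, hcorner, add_idem]
  have h2 : (cornerTerm true false (0 : ZMod m)).eval
      (.pt : PrismEdge m → (PrismEdge.hypergraph hm).Alg) = .zero := by
    simp only [cornerTerm, Term.eval]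
    rw [LinearHypergraph.Alg.pt_mul_pt_mul_pt, if_neg]
    simp [PrismEdge.hypergraph, PrismEdge.third]
  simp only [Term.eval, h1, h2]
  rw [LinearHypergraph.Alg.add_of_ne (by nofun)]
  nofun

theorem not_isFinitelyBased_abc : ¬ IsFinitelyBased (generatedVariety (Sc abc)) := by
  rintro ⟨E, hE⟩
  let N := E.sup fun e => max e.1.bound e.2.bound
  -- The number 2N + 3 is odd, at least 3, and exceeds the number `N` of variables.
  have hm : 3 ≤ 2 * N + 3 := by omega
  have hA : generatedVariety (Sc abc) (PrismEdge.hypergraph hm).Alg := by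
    rw [hE]
    intro e he
    have h1 : max e.1.bound e.2.bound ≤ N :=
      Finset.le_sup (f := fun e : Identity => max e.1.bound e.2.bound) he
    exact satisfies_prism hm ((hE _).1 (generatedVariety_self _) e he) (by omega)
  exact eval_prismTerm_ne hm (hA.eval_eq (eval_prismTerm (by omega)) _)

/-! ### Groups -/

theorem subsingleton_of_generatedVariety {A : Type} [AiSemiring A]
    (hA : generatedVariety (Sc abc) A) {G : Type} [Group G] (f : G →ₙ* A)
    (hf : Function.Injective f) : Subsingleton G := by
  obtain ⟨o, h⟩ := exists_isNilTop_of_generatedVariety hA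
  have h4 := h.satisfies_nilFourIdentity.1 (hA.satisfies satisfies_nilFourIdentity_abc)
  have ho (g : G) : f g = o := by
    rw [← h4 (f g) (f 1) (f 1) (f 1), ← map_mul, ← map_mul, ← map_mul]
    simp
  exact ⟨fun a b => hf ((ho a).trans (ho b).symm)⟩

theorem not_generatedVariety_flatExt (G : Type) [Group G] :
    ¬ generatedVariety (Sc abc) (FlatExt G) := by
  intro hA
  obtain ⟨o, h⟩ := exists_isNilTop_of_generatedVariety hA
  let e : FlatExt G := (some 1 : Option G)
  have h1 : e * e = e := congrArg (some : G → Option G) (mul_one 1)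
  have h2 : (0 * 0 : FlatExt G) = 0 := mul_zero 0
  have h3 : e = 0 := by
    rw [← h1, ← h2, h.mul_self, h.mul_self]
  exact Option.some_ne_none _ h3

instance : Finite (Sc abc) :=
  have : Finite {u : Multiset (Fin 3) // u ≠ 0 ∧ u ≤ abc} :=
    ((Set.finite_Iic abc).subset fun _ h => h.2).to_subtype
  inferInstanceAs (Finite (Option {u : Multiset (Fin 3) // u ≠ 0 ∧ u ≤ abc}))

end AiSemiring

theorem theorem2 :
    -- `S_c(abc)` is a flat semiring and the variety that it generates is a limit variety
    AiSemiring.IsFlat (AiSemiring.Sc AiSemiring.abc) ∧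
    AiSemiring.IsLimitVariety
      (AiSemiring.generatedVariety (AiSemiring.Sc AiSemiring.abc)) ∧
    -- it is finitely generated and has only trivial subgroups
    AiSemiring.IsCombinatorial
      (AiSemiring.generatedVariety (AiSemiring.Sc AiSemiring.abc)) ∧
    -- it contains no flat extension of a group
    ∀ (G : Type) [Group G],
      ¬ AiSemiring.generatedVariety (AiSemiring.Sc AiSemiring.abc) (AiSemiring.FlatExt G) :=
  ⟨AiSemiring.Sc.isFlat,
    ⟨AiSemiring.isVariety_generatedVariety _, AiSemiring.not_isFinitelyBased_abc,
      fun _ hW => hW.isFinitelyBased⟩,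
    ⟨⟨AiSemiring.Sc AiSemiring.abc, inferInstance, inferInstance, fun _ _ => Iff.rfl⟩,
      fun _ _ hA _ _ f hf => AiSemiring.subsingleton_of_generatedVariety hA f hf⟩,
    fun G _ => AiSemiring.not_generatedVariety_flatExt G⟩
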